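/- **Setting.** Let $\omega=e^{i\pi/3}$ and let $\Lambda=\mathbb Z+\mathbb Z\omega\subset\mathbb C$ be the triangular lattice. A *triangulation* of a region $\Omega\subseteq\mathbb C$ (for instance a polygon with lattice vertices) is a set of non-degenerate lattice triangles that cover $\Omega$, meet face to face, and use every lattice point of $\Omega$ as a vertex; it is *equilateral* if all its edges have the same length. A *flip* replaces, in a strictly convex quadrilateral formed by two triangles of a triangulation, the diagonal that is present with the other diagonal. A *flip path* from a triangulation is a finite sequence of flips that can be performed one after the other. It *generates* a set of edges if the last triangulation contains these edges. A *flip plan* that generates a set $E$ of edges from a triangulation $T$ is a finite partially ordered set $\pi$ of flips whose valid linear orderings are exactly the flip paths from $T$ that generate $E$ and whose set of flips is exactly $\pi$. An *edge* $e=(x,y)$ is a vector $xp+yq$ with $x,y\ge 0$ coprime integers, where $(p,q)$ is one of the three pairs $(1,\omega),(\omega,\omega^2),(\omega^2,\omega^3)$; the edge $e$ at a lattice point $v$ is the segment from $v$ to $v+e$. Put $\phi_e=x/y$ if $x<y$ and $\phi_e=y/x$ otherwise. A fraction $a/b$ in $[0,1]$ in lowest terms is turned back into an edge, written $\phi_e^{-1}(a/b)$,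 with the same pair $(p,q)$: it is $(a,b)$ if $x<y$, and $(b,a)$ otherwise. If $e$ is not a unit vector, its *Farey parallelogram* $P_{e,v}$ at $v$ has the diagonal $e$ at $v$ and has as sides copies of the two edges obtained in this way from the neighbors of $\phi_e$ in the first Farey sequence that contains $\phi_e$ (for $e=(1,1)$ the sides are $(0,1)$ and $(1,0)$). *Algorithm Farey Plan* returns the empty list for $(1,0)$ and $(0,1)$. Otherwise it starts with $d=\frac11$ and the sequence $X=(\frac01,\frac11)$, and records $d$; as long as $d\ne\phi_e$, it replaces $d$ by the mediant of $d$ and its successor in $X$ (if $d<\phi_e$) or its predecessor in $X$ (if $d>\phi_e$), inserts the new $d$ into $X$, and records it. The list of recorded fractions is the *Farey plan* $f_1,\dots,f_n$ of $e$. *Algorithm Flip Plan* on $e$ at $v$ with Farey plan $f_1,\dots,f_n$ returns a partially ordered set $\pi_{e,v}$ of flips. It is empty if $n=0$. If $n=1$ (that is, $e=(1,1)$), it is the single flip that creates $e$ in $P_{e,v}$. If $n\ge2$, it has as root the flip that creates $e$ in $P_{e,v}$, and the children of the root are the roots of the outputs on $e_1$ at $v$ and on $e_1$ at $v+e_2$,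 both with Farey plan $f_1,\dots,f_{n-1}$. Here $e_1=\phi_e^{-1}(f_{n-1})$ is the longer and $e_2$ is the shorter boundary edge of $P_{e,v}$. Equal flips are identified; descendants precede ancestors. For partially ordered sets $\pi,\pi'$ obtained in this way, $\pi\cup\pi'$ denotes their union with common flips identified. For $u\neq v$, the outputs $\pi_{e,u}$ and $\pi_{e,v}$ are *adjacent* if $e$ is not a unit vector and the root parallelograms $P_{e,u}$ and $P_{e,v}$ share a side. The edges $e$ at $u$ and $e$ at $v$ are *adjacent copies of $e$* in a triangulation if it contains both edges and, for each of $P_{e,u},P_{e,v}$, one of the two triangles into which $e$ cuts it, and these two triangles share an edge. **Theorem.** Let $T$ be an equilateral triangulation of a region $\Omega$, and let $e$ be an edge. 1. If $\pi_{e,u}$ and $\pi_{e,v}$ are adjacent outputs of Algorithm Flip Plan, and the edges $e$ at $u$ and $e$ at $v$ lie in $\Omega$, then $\pi_{e,u}\cup\pi_{e,v}$ is a flip plan that generates $e$ at $u$ and $e$ at $v$ from $T$. Moreover, in the triangulation obtained by performing any valid linear ordering of it, these are adjacent copies of $e$. 2. If the edge $e$ at $v$ lies in $\Omega$, then $\pi_{e,v}$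 is a flip plan that generates $e$ at $v$ from $T$: its valid linear orderings are exactly the flip paths from $T$ that generate $e$ at $v$ and whose set of flips is exactly $\pi_{e,v}$. -/

import Mathlib

namespace FareyFlip

/-! ### The triangular lattice -/

/-- A point of the triangular lattice, in coordinates with respect to two unit vectors that
make an angle of 60 degrees. -/
abbrev Pt : Type := ℤ × ℤ

/-- The position of a lattice point in the Euclidean plane `ℂ`: the lattice is `ℤ + ℤ ω` with
`ω = exp (i π / 3) = 1/2 + (√3/2) i`. -/
noncomputable def emb (p : Pt) : ℂ :=
  (p.1 : ℂ) + (p.2 : ℂ) * (⟨1 / 2, Real.sqrt 3 / 2⟩ : ℂ)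

/-- Anticlockwise rotation by 60 degrees (multiplication by `ω`, where `ω ^ 2 = ω - 1`). -/
def rot (p : Pt) : Pt := (-p.2, p.1 + p.2)

/-- The unit vector of the lattice at angle `60 k` degrees. -/
def unitVec (k : ℕ) : Pt := rot^[k] (1, 0)

/-! ### Triangulations -/

/-- The closed triangle spanned by a set of lattice points. -/
noncomputable def hull (t : Finset Pt) : Set ℂ := convexHull ℝ (emb '' (t : Set Pt))

/-- `T`, given by the vertex sets of its triangles, is a (lattice) triangulation of the region
`Ω`: non-degenerate lattice triangles that cover `Ω`, meet face to face, and use every lattice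
point of `Ω` as a vertex. -/
structure IsTriangulation (Ω : Set ℂ) (T : Set (Finset Pt)) : Prop where
  card_eq : ∀ t ∈ T, t.card = 3
  nondegenerate : ∀ t ∈ T, AffineIndependent ℝ (fun p : t => emb p)
  cover : (⋃ t ∈ T, hull t) = Ω
  face_to_face : ∀ t ∈ T, ∀ t' ∈ T, hull t ∩ hull t' = hull (t ∩ t')
  uses_all : ∀ p : Pt, emb p ∈ Ω → ∃ t ∈ T, p ∈ t

/-- The edges of a collection of triangles. -/
def edges (T : Set (Finset Pt)) : Set (Sym2 Pt) :=
  {s | ∃ a b : Pt, a ≠ b ∧ s = s(a, b) ∧ ∃ t ∈ T, a ∈ t ∧ b ∈ t}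

/-- A triangulation of `Ω` all of whose edges have the same length. -/
structure IsEquilateralTriangulation (Ω : Set ℂ) (T : Set (Finset Pt)) : Prop
    extends IsTriangulation Ω T where
  equal_length : ∀ a b c d : Pt, s(a, b) ∈ edges T → s(c, d) ∈ edges T →
    dist (emb a) (emb b) = dist (emb c) (emb d)

/-! ### Flips and flip paths -/

/-- A flip on a quadrilateral: the diagonal `old` is replaced with the diagonal `new`. -/
structure Flip where
  old : Sym2 Pt
  new : Sym2 Pt
deriving DecidableEq

/-- The flip `s` can be performed in `T` and yields `T'`. The quadrilateral `a b c d` consists of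
the triangles `a b c` and `a c d` of `T`; it is (strictly) convex, that is, its diagonals cross
in a relatively interior point of both. If `T` is a triangulation of a region, then so is `T'`, since
the same convex quadrilateral is covered. -/
def Performs (T : Set (Finset Pt)) (s : Flip) (T' : Set (Finset Pt)) : Prop :=
  ∃ a b c d : Pt, s.old = s(a, c) ∧ s.new = s(b, d) ∧
    ({a, b, c} : Finset Pt) ∈ T ∧ ({a, c, d} : Finset Pt) ∈ T ∧
    (openSegment ℝ (emb a) (emb c) ∩ openSegment ℝ (emb b) (emb d)).Nonempty ∧
    T' = (T \ {({a, b, c} : Finset Pt), ({a, c, d} : Finset Pt)}) ∪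
      {({a, b, d} : Finset Pt), ({b, c, d} : Finset Pt)}

/-- `FlipPath T l T'`: the flips of `l` can be performed one after the other, starting from `T`,
and the result is `T'`. -/
inductive FlipPath : Set (Finset Pt) → List Flip → Set (Finset Pt) → Prop
  | nil (T : Set (Finset Pt)) : FlipPath T [] T
  | cons {T T₁ T' : Set (Finset Pt)} {s : Flip} {l : List Flip}
      (h : Performs T s T₁) (hl : FlipPath T₁ l T') : FlipPath T (s :: l) T'

/-! ### Partially ordered sets of flips and flip plans -/

/-- A finite set of flips with parent-child arcs; `(s, t) ∈ child` says that `t` is a child of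
`s`. -/
structure FlipPoset where
  flips : Finset Flip
  child : Finset (Flip × Flip)

/-- `D.Below t s`: `t` is strictly below `s`, i.e. a descendant of `s`; `t` must be performed
before `s`. -/
def FlipPoset.Below (D : FlipPoset) (t s : Flip) : Prop :=
  Relation.TransGen (fun x y => (y, x) ∈ D.child) t s

/-- The union of two partially ordered sets of flips; common flips are merged. -/
def FlipPoset.union (D D' : FlipPoset) : FlipPoset :=
  ⟨D.flips ∪ D'.flips, D.child ∪ D'.child⟩

/-- `l` lists every flip of `D` exactly once, in an order compatible with that of `D`. -/
def FlipPoset.IsLinearOrdering (D : FlipPoset) (l : List Flip) : Prop :=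
  l.Nodup ∧ (∀ s, s ∈ l ↔ s ∈ D.flips) ∧ l.Pairwise (fun s t => ¬ D.Below t s)

/-- `D` is a flip plan that generates the set of edges `E` from the triangulation `T`: `D` is
partially ordered (has no directed cycle), and its valid linear orderings are exactly the flip
paths that start in `T`, end in a triangulation containing `E`, and consist of exactly the flips
in `D`. -/
def IsFlipPlan (D : FlipPoset) (T : Set (Finset Pt)) (E : Set (Sym2 Pt)) : Prop :=
  (∀ s, ¬ D.Below s s) ∧
  ∀ l : List Flip, D.IsLinearOrdering l ↔
    (∃ T', FlipPath T l T' ∧ E ⊆ edges T') ∧ ∀ s, s ∈ l ↔ s ∈ D.flips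

/-! ### Edges and Farey sequences -/

/-- An edge (up to translation): coprime nonnegative coordinates `(x, y)` with respect to its
defining coordinate pair. The three pairs are `(unitVec k, unitVec (k + 1))`, `k = 0, 1, 2`;
nonnegative coordinates mean that the edge lies in the 60 degree sector of the pair, and this is
the pair for which `|x| + |y|` is minimal. -/
structure Edge where
  pair : Fin 3
  x : ℕ
  y : ℕ
  coprime : Nat.Coprime x y

/-- The lattice vector of an edge. -/
def Edge.vec (e : Edge) : Pt :=
  (e.x : ℤ) • unitVec e.pair + (e.y : ℤ) • unitVec (e.pair + 1 : ℕ)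

/-- The edge `e` at the point `v`, as an (unoriented) pair of lattice points. -/
def Edge.at (e : Edge) (v : Pt) : Sym2 Pt := s(v, v + e.vec)

/-- The edge `e` at the point `v`, as a segment in the plane. -/
noncomputable def Edge.seg (e : Edge) (v : Pt) : Set ℂ := segment ℝ (emb v) (emb (v + e.vec))

/-- The Farey sequence of order `n`: all fractions in `[0, 1]` with denominator at most `n`, in
increasing order. -/
def fareySeq (n : ℕ) : List ℚ :=
  (((Finset.range (n + 1) ×ˢ Finset.Icc 1 n).filter (fun p => p.1 ≤ p.2)).image
    (fun p => (p.1 : ℚ) / (p.2 : ℚ))).sort (· ≤ ·)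

/-- The term directly before `d` in the increasing sequence `X`. -/
def before (X : List ℚ) (d : ℚ) : ℚ := (X.filter (fun q => q < d)).getLastD 0

/-- The term directly after `d` in the increasing sequence `X`. -/
def after (X : List ℚ) (d : ℚ) : ℚ := (X.filter (fun q => d < q)).headD 1

/-- The mediant of two reduced fractions. -/
def mediant (q r : ℚ) : ℚ := ((q.num + r.num : ℤ) : ℚ) / ((q.den + r.den : ℕ) : ℚ)

/-- The Farey-flip map: `x / y` if `x < y`, and `y / x` otherwise. -/
def Edge.phi (e : Edge) : ℚ := if e.x < e.y then (e.x : ℚ) / e.y else (e.y : ℚ) / e.x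

/-- The inverse Farey-flip map selected by `e`: it keeps the defining coordinate pair of `e` and
the order of the coordinates. -/
def Edge.phiInv (e : Edge) (f : ℚ) : Edge :=
  if e.x < e.y then ⟨e.pair, f.num.natAbs, f.den, f.reduced⟩
  else ⟨e.pair, f.den, f.num.natAbs, Nat.Coprime.symm f.reduced⟩

/-- The two boundary edges of the Farey parallelogram of `e`: the Farey neighbor edges of `e` in
the first Farey sequence that contains `e`, and `(0, 1)`, `(1, 0)` if `e` is the edge `(1, 1)`. -/
def Edge.neighbors (e : Edge) : Edge × Edge :=
  if e.x = 1 ∧ e.y = 1 then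
    (⟨e.pair, 0, 1, Nat.coprime_one_right 0⟩, ⟨e.pair, 1, 0, Nat.coprime_one_left 0⟩)
  else
    (e.phiInv (before (fareySeq e.phi.den) e.phi), e.phiInv (after (fareySeq e.phi.den) e.phi))

/-- The squared Euclidean length of `e`, by the law of cosines in the triangular lattice. -/
def Edge.sqLength (e : Edge) : ℕ := e.x ^ 2 + e.x * e.y + e.y ^ 2

/-- The shorter boundary edge of the Farey parallelogram of `e`. -/
def Edge.shorterNeighbor (e : Edge) : Edge :=
  if e.neighbors.1.sqLength ≤ e.neighbors.2.sqLength then e.neighbors.1 else e.neighbors.2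

/-- The four sides of the Farey parallelogram of `e` at `v`. -/
def Edge.sides (e : Edge) (v : Pt) : Finset (Sym2 Pt) :=
  {s(v, v + e.neighbors.1.vec), s(v, v + e.neighbors.2.vec),
    s(v + e.neighbors.1.vec, v + e.vec), s(v + e.neighbors.2.vec, v + e.vec)}

/-- The flip on the Farey parallelogram of `e` at `v`: it replaces the other diagonal with `e`. -/
def Edge.flip (e : Edge) (v : Pt) : Flip :=
  ⟨s(v + e.neighbors.1.vec, v + e.neighbors.2.vec), e.at v⟩

/-- The two halves into which the edge `e` cuts its Farey parallelogram at `v`. -/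
def Edge.halves (e : Edge) (v : Pt) : Finset (Finset Pt) :=
  {{v, v + e.neighbors.1.vec, v + e.vec}, {v, v + e.neighbors.2.vec, v + e.vec}}

/-! ### The algorithms -/

/-- The loop of Algorithm Farey Plan with target fraction `f`, current sequence `X` and current
fraction `d`. The first argument bounds the number of iterations. -/
def fareyLoop (f : ℚ) : ℕ → List ℚ → ℚ → List ℚ
  | 0, _, _ => []
  | n + 1, X, d =>
    if d = f then [d]
    else
      let d' := if d < f then mediant d (after X d) else mediant d (before X d)
      d :: fareyLoop f n (X.orderedInsert (· ≤ ·) d') d'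

/-- Algorithm Farey Plan. The denominator of the target fraction is a sufficient number of
iterations, since the denominators of the fractions produced increase strictly. -/
def Edge.fareyPlan (e : Edge) : List ℚ :=
  if (e.x = 0 ∧ e.y = 1) ∨ (e.x = 1 ∧ e.y = 0) then []
  else fareyLoop e.phi e.phi.den (fareySeq 1) 1

/-- Algorithm Flip Plan on the edge `e` at the point `v`; the first argument is the Farey plan of
`e`, last fraction first. The longer boundary edge of the Farey parallelogram is obtained from
the last fraction but one. Flips and arcs form sets, so duplicate flips are consolidated. -/
def flipPlanAux : List ℚ → Edge → Pt → FlipPoset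
  | [], _, _ => ⟨∅, ∅⟩
  | [_], e, v => ⟨{e.flip v}, ∅⟩
  | _ :: g :: C, e, v =>
    let e₁ := e.phiInv g
    let w := v + e.shorterNeighbor.vec
    let D := flipPlanAux (g :: C) e₁ v
    let D' := flipPlanAux (g :: C) e₁ w
    ⟨{e.flip v} ∪ (D.flips ∪ D'.flips),
      {(e.flip v, e₁.flip v), (e.flip v, e₁.flip w)} ∪ (D.child ∪ D'.child)⟩

/-- The output of Algorithm Flip Plan on the edge `e` at the point `v` and its Farey plan. -/
def Edge.flipPlan (e : Edge) (v : Pt) : FlipPoset := flipPlanAux e.fareyPlan.reverse e v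

/-! ### Adjacency -/

/-- The outputs of Algorithm Flip Plan on `e` at `u` and on `e` at `v` are adjacent: they have
root flips (`e` is not a unit edge), and their two root parallelograms, which are different,
share a side. -/
def AdjacentPlans (e : Edge) (u v : Pt) : Prop :=
  e.fareyPlan ≠ [] ∧ u ≠ v ∧ (e.sides u ∩ e.sides v).Nonempty

/-- In `T` the edges `e` at `u` and `e` at `v` are adjacent copies of `e`: both edges and one
half of each of their Farey parallelograms exist in `T`, and these halves share an edge. -/
def AdjacentCopies (T : Set (Finset Pt)) (e : Edge) (u v : Pt) : Prop :=
  u ≠ v ∧ e.at u ∈ edges T ∧ e.at v ∈ edges T ∧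
    ∃ t ∈ e.halves u, ∃ t' ∈ e.halves v, t ∈ T ∧ t' ∈ T ∧ (t ∩ t').card = 2

end FareyFlip

/-!
Read the triangles as the places of a Petri net and the flips of a plan as its transitions. Every
triangle is removed by at most one flip of the plan and created by at most one, and none that the
plan creates is present at the start. The net is thus a marked graph, in which a list using exactly
the flips of the plan can be performed if and only if it is a linear ordering: a flip is enabled
precisely when its children have been performed.

The two unit vectors `P`, `Q` that frame `e` form a lattice basis, and the Farey plan of `e` is a
path in the Stern–Brocot tree, whose steps replace one of two basis vectors by their sum. The sum
of the coordinates with respect to `P`, `Q` orders the vertices of a created triangle, and the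
differences of the ordered vertices recover the path by the Euclidean algorithm; so the triangle
determines the flip. A triangle of `T` has unit sides, so its vertices differ by at most one in
this sum and no flip creates it.

Each triangle that a non-leaf flip removes is created by one of its two children. The leaves are
flips on unit rhombi; `e` crosses the diagonal of each in the interior, so points of `e`
on either side of this diagonal show that both halves of the rhombus belong to `T`.
-/

namespace FareyFlip

/-! ### Flips and flip paths as operations on sets of triangles -/

/-- The two triangles that the flip `s` removes. -/
def Flip.removed (s : Flip) : Set (Finset Pt) := {τ | ∃ b ∈ s.new, τ = insert b s.old.toFinset}

/-- The two triangles that the flip `s` creates. -/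
def Flip.created (s : Flip) : Set (Finset Pt) := {τ | ∃ a ∈ s.old, τ = insert a s.new.toFinset}

/-- The diagonals of the quadrilateral of `s` cross, so that `s` can be performed as soon as the
two triangles that it removes are present. -/
def Flip.IsConvex (s : Flip) : Prop :=
  ∃ a b c d : Pt, s.old = s(a, c) ∧ s.new = s(b, d) ∧
    (openSegment ℝ (emb a) (emb c) ∩ openSegment ℝ (emb b) (emb d)).Nonempty

theorem Flip.removed_mk (a b c d : Pt) :
    (Flip.mk s(a, c) s(b, d)).removed = {{a, b, c}, {a, c, d}} := by
  ext τ
  simp only [Flip.removed, Sym2.mem_iff, Sym2.toFinset_mk_eq, exists_eq_or_imp, exists_eq_left,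
    Set.mem_ofPred_eq, Set.mem_insert_iff, Set.mem_singleton_iff]
  rw [Finset.insert_comm b a, Finset.insert_comm d a, Finset.pair_comm d c]

theorem Flip.created_mk (a b c d : Pt) :
    (Flip.mk s(a, c) s(b, d)).created = {{a, b, d}, {b, c, d}} := by
  ext τ
  simp only [Flip.created, Sym2.mem_iff, Sym2.toFinset_mk_eq, exists_eq_or_imp, exists_eq_left,
    Set.mem_ofPred_eq, Set.mem_insert_iff, Set.mem_singleton_iff]
  rw [Finset.insert_comm c b]

theorem Flip.removed_nonempty (s : Flip) : s.removed.Nonempty := by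
  obtain ⟨old, new⟩ := s
  induction new with
  | _ b d => exact ⟨_, b, Sym2.mem_mk_left b d, rfl⟩

theorem performs_iff {T T' : Set (Finset Pt)} {s : Flip} :
    Performs T s T' ↔ s.IsConvex ∧ s.removed ⊆ T ∧ T' = (T \ s.removed) ∪ s.created := by
  obtain ⟨old, new⟩ := s
  constructor
  · rintro ⟨a, b, c, d, rfl, rfl, habc, hacd, hcross, hT'⟩
    rw [Flip.removed_mk, Flip.created_mk]
    exact ⟨⟨a, b, c, d, rfl, rfl, hcross⟩, Set.pair_subset habc hacd, hT'⟩
  · rintro ⟨⟨a, b, c, d, rfl, rfl, hcross⟩, hT, hT'⟩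
    rw [Flip.removed_mk] at hT
    rw [Flip.removed_mk, Flip.created_mk] at hT'
    exact ⟨a, b, c, d, rfl, rfl, hT (by simp), hT (by simp), hcross, hT'⟩

theorem flipPath_cons {T T' : Set (Finset Pt)} {s : Flip} {l : List Flip} :
    FlipPath T (s :: l) T' ↔ ∃ T₁, Performs T s T₁ ∧ FlipPath T₁ l T' := by
  constructor
  · rintro (_ | ⟨h, hl⟩)
    exact ⟨_, h, hl⟩
  · rintro ⟨_, h, hl⟩
    exact .cons h hl

theorem flipPath_append {T T' : Set (Finset Pt)} {l m : List Flip} :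
    FlipPath T (l ++ m) T' ↔ ∃ T₁, FlipPath T l T₁ ∧ FlipPath T₁ m T' := by
  induction l generalizing T with
  | nil =>
    refine ⟨fun h => ⟨T, .nil T, h⟩, ?_⟩
    rintro ⟨_, ⟨⟩, h⟩
    exact h
  | cons s l ih =>
    simp only [List.cons_append, flipPath_cons, ih]
    constructor
    · rintro ⟨T₁, hs, T₂, hl, hm⟩
      exact ⟨T₂, ⟨T₁, hs, hl⟩, hm⟩
    · rintro ⟨T₂, ⟨T₁, hs, hl⟩, hm⟩
      exact ⟨T₁, hs, T₂, hl, hm⟩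

theorem FlipPath.unique {T T₁ T₂ : Set (Finset Pt)} {l : List Flip} (h₁ : FlipPath T l T₁)
    (h₂ : FlipPath T l T₂) : T₁ = T₂ := by
  induction h₁ with
  | nil => cases h₂; rfl
  | cons hs _ ih =>
    obtain ⟨_, hs', hl'⟩ := flipPath_cons.1 h₂
    obtain rfl := (performs_iff.1 hs).2.2.trans (performs_iff.1 hs').2.2.symm
    exact ih hl'

theorem FlipPath.mem_or_mem_created {T T' : Set (Finset Pt)} {l : List Flip}
    (h : FlipPath T l T') {τ : Finset Pt} (hτ : τ ∈ T') : τ ∈ T ∨ ∃ s ∈ l, τ ∈ s.created := by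
  induction h with
  | nil => exact Or.inl hτ
  | cons hs _ ih =>
    rcases ih hτ with hτ₁ | ⟨t, ht, hτt⟩
    · rw [(performs_iff.1 hs).2.2] at hτ₁
      exact hτ₁.imp (fun hτ₁ => hτ₁.1) fun hτs => ⟨_, List.mem_cons_self, hτs⟩
    · exact Or.inr ⟨t, List.mem_cons_of_mem _ ht, hτt⟩

/-- The triangles that are initially in `T` or created by a flip of `l`, and removed by no flip of
`l`. After a flip path `l` from `T` these are the triangles present, provided that no triangle is
created after its removal. -/
def trianglesAfter (T : Set (Finset Pt)) (l : List Flip) : Set (Finset Pt) :=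
  {τ | (τ ∈ T ∨ ∃ s ∈ l, τ ∈ s.created) ∧ ∀ s ∈ l, τ ∉ s.removed}

theorem trianglesAfter_nil (T : Set (Finset Pt)) : trianglesAfter T [] = T := by
  simp [trianglesAfter]

theorem trianglesAfter_concat (T : Set (Finset Pt)) {l : List Flip} {s : Flip}
    (h : ∀ t ∈ l ++ [s], Disjoint s.created t.removed) :
    trianglesAfter T (l ++ [s]) = (trianglesAfter T l \ s.removed) ∪ s.created := by
  ext τ
  have hs : τ ∈ s.created → ∀ t ∈ l ++ [s], τ ∉ t.removed :=
    fun hτ t ht => (h t ht).notMem_of_mem_left hτ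
  simp only [trianglesAfter, Set.mem_ofPred_eq, Set.mem_union, Set.mem_sdiff]
  grind

/-! ### Flip posets that are marked graphs -/

/-- Flips as the transitions of a Petri net whose places are the triangles: the net of `D` is a
marked graph with initial marking `T`, that is, every triangle has at most one producer and at
most one consumer in `D`, and no triangle of `T` has a producer. The arcs of `D` lead from the
consumer of a triangle to its producer, and `rank` decreases along them. -/
structure FlipPoset.IsMarkedGraph (D : FlipPoset) (T : Set (Finset Pt)) (rank : Flip → ℕ) :
    Prop where
  convex : ∀ s ∈ D.flips, s.IsConvex
  removed_inj : ∀ s ∈ D.flips, ∀ t ∈ D.flips, ∀ τ, τ ∈ s.removed → τ ∈ t.removed → s = t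
  created_inj : ∀ s ∈ D.flips, ∀ t ∈ D.flips, ∀ τ, τ ∈ s.created → τ ∈ t.created → s = t
  created_notMem : ∀ s ∈ D.flips, ∀ τ ∈ s.created, τ ∉ T
  removed_mem : ∀ s ∈ D.flips, ∀ τ ∈ s.removed, τ ∈ T ∨ ∃ c, (s, c) ∈ D.child ∧ τ ∈ c.created
  child_mem : ∀ s c, (s, c) ∈ D.child → s ∈ D.flips ∧ c ∈ D.flips
  child_rank : ∀ s c, (s, c) ∈ D.child → rank c < rank s
  child_created : ∀ s c, (s, c) ∈ D.child → ∃ τ ∈ s.removed, τ ∈ c.created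

theorem exists_eq_append_of_pair_sublist {α : Type*} {a b : α} {L : List α}
    (h : List.Sublist [a, b] L) : ∃ l m r, L = l ++ a :: (m ++ b :: r) := by
  obtain ⟨L₁, L₂, rfl, ha, hb⟩ := List.cons_sublist_iff.1 h
  obtain ⟨l, m₁, rfl⟩ := List.append_of_mem ha
  obtain ⟨m₂, r, rfl⟩ := List.append_of_mem (List.singleton_sublist.1 hb)
  exact ⟨l, m₁ ++ m₂, r, by simp⟩

namespace FlipPoset.IsMarkedGraph

variable {D : FlipPoset} {T T' : Set (Finset Pt)} {rank : Flip → ℕ}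

theorem rank_lt_of_below (h : D.IsMarkedGraph T rank) {s t : Flip} (hts : D.Below t s) :
    rank t < rank s := by
  induction hts with
  | single hchild => exact h.child_rank _ _ hchild
  | tail _ hchild ih => exact ih.trans (h.child_rank _ _ hchild)

theorem not_below_self (h : D.IsMarkedGraph T rank) (s : Flip) : ¬ D.Below s s :=
  fun hs => lt_irrefl _ (h.rank_lt_of_below hs)

theorem child_of_mem_created_of_mem_removed (h : D.IsMarkedGraph T rank) {s t : Flip}
    (hs : s ∈ D.flips) (ht : t ∈ D.flips) {τ : Finset Pt} (hτs : τ ∈ s.created)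
    (hτt : τ ∈ t.removed) : (t, s) ∈ D.child := by
  rcases h.removed_mem t ht τ hτt with hτT | ⟨c, hc, hτc⟩
  · exact absurd hτT (h.created_notMem s hs τ hτs)
  · rwa [h.created_inj s hs c (h.child_mem _ _ hc).2 τ hτs hτc]

theorem disjoint_created_removed (h : D.IsMarkedGraph T rank) {s t : Flip} (hs : s ∈ D.flips)
    (ht : t ∈ D.flips) (hst : ¬ D.Below s t) : Disjoint s.created t.removed :=
  Set.disjoint_left.2 fun _ hτs hτt =>
    hst (.single (h.child_of_mem_created_of_mem_removed hs ht hτs hτt))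

theorem performs_trianglesAfter (h : D.IsMarkedGraph T rank) {l r : List Flip} {s : Flip}
    (hl : D.IsLinearOrdering (l ++ s :: r)) :
    Performs (trianglesAfter T l) s (trianglesAfter T (l ++ [s])) := by
  obtain ⟨hnodup, hmem, hpw⟩ := hl
  simp only [List.pairwise_append, List.pairwise_cons, List.nodup_append] at hpw hnodup
  have hs : s ∈ D.flips := (hmem s).1 (by simp)
  have hl : ∀ t ∈ l, t ∈ D.flips := fun t ht => (hmem t).1 (List.mem_append_left _ ht)
  refine performs_iff.2 ⟨h.convex s hs, fun τ hτ => ⟨?_, ?_⟩, trianglesAfter_concat T ?_⟩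
  · refine (h.removed_mem s hs τ hτ).imp id fun ⟨c, hc, hτc⟩ => ⟨c, ?_, hτc⟩
    have hcs : D.Below c s := .single hc
    have hc_mem := (hmem c).2 (h.child_mem _ _ hc).2
    simp only [List.mem_append, List.mem_cons] at hc_mem
    rcases hc_mem with hcl | rfl | hcr
    · exact hcl
    · exact absurd hcs (h.not_below_self c)
    · exact absurd hcs (hpw.2.1.1 c hcr)
  · exact fun t ht hτt =>
      hnodup.2.2 t ht s List.mem_cons_self (h.removed_inj t (hl t ht) s hs τ hτt hτ)
  · simp only [List.mem_append, List.mem_singleton]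
    rintro t (ht | rfl)
    · exact h.disjoint_created_removed hs (hl t ht) (hpw.2.2 t ht s List.mem_cons_self)
    · exact h.disjoint_created_removed hs hs (h.not_below_self t)

theorem flipPath_of_prefix (h : D.IsMarkedGraph T rank) {l : List Flip}
    (hl : D.IsLinearOrdering l) {m : List Flip} (hm : m <+: l) :
    FlipPath T m (trianglesAfter T m) := by
  induction m using List.reverseRecOn with
  | nil =>
    rw [trianglesAfter_nil]
    exact .nil T
  | append_singleton m s ih =>
    have hpath := ih ((List.prefix_append m [s]).trans hm)
    obtain ⟨r, rfl⟩ := hm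
    rw [List.append_assoc] at hl
    exact flipPath_append.2 ⟨_, hpath, flipPath_cons.2 ⟨_, h.performs_trianglesAfter hl, .nil _⟩⟩

theorem flipPath_of_isLinearOrdering (h : D.IsMarkedGraph T rank) {l : List Flip}
    (hl : D.IsLinearOrdering l) : FlipPath T l (trianglesAfter T l) :=
  h.flipPath_of_prefix hl List.prefix_rfl

theorem mem_of_mem_created (h : D.IsMarkedGraph T rank) {l : List Flip}
    (hl : D.IsLinearOrdering l) (hp : FlipPath T l T') {s : Flip} (hs : s ∈ D.flips)
    (hmax : ∀ t, (t, s) ∉ D.child) {τ : Finset Pt} (hτ : τ ∈ s.created) : τ ∈ T' := by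
  rw [hp.unique (h.flipPath_of_isLinearOrdering hl)]
  exact ⟨Or.inr ⟨s, (hl.2.1 s).2 hs, hτ⟩, fun t ht hτt =>
    hmax t (h.child_of_mem_created_of_mem_removed hs ((hl.2.1 t).1 ht) hτ hτt)⟩

theorem child_mem_of_flipPath (h : D.IsMarkedGraph T rank) {l m : List Flip} {s c : Flip}
    (hp : FlipPath T (l ++ s :: m) T') (hl : ∀ t ∈ l, t ∈ D.flips) (hc : (s, c) ∈ D.child) :
    c ∈ l := by
  obtain ⟨T₁, hp₁, hp⟩ := flipPath_append.1 hp
  obtain ⟨T₂, hs, -⟩ := flipPath_cons.1 hp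
  obtain ⟨τ, hτs, hτc⟩ := h.child_created _ _ hc
  have hcD := (h.child_mem _ _ hc).2
  rcases hp₁.mem_or_mem_created ((performs_iff.1 hs).2.1 hτs) with hτT | ⟨t, ht, hτt⟩
  · exact absurd hτT (h.created_notMem c hcD τ hτc)
  · rwa [h.created_inj c hcD t (hl t ht) τ hτc hτt]

theorem mem_of_below_of_flipPath (h : D.IsMarkedGraph T rank) {s t : Flip} (hts : D.Below t s) :
    ∀ {l m : List Flip}, FlipPath T (l ++ s :: m) T' → (∀ t ∈ l, t ∈ D.flips) → t ∈ l := by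
  induction hts with
  | single hchild => exact fun hp hl => h.child_mem_of_flipPath hp hl hchild
  | tail _ hchild ih =>
    intro l m hp hl
    obtain ⟨l₁, l₂, rfl⟩ := List.append_of_mem (h.child_mem_of_flipPath hp hl hchild)
    rw [List.append_assoc, List.cons_append] at hp
    exact List.mem_append_left _ (ih hp fun t ht => hl t (List.mem_append_left _ ht))

theorem exists_child_mem_of_flipPath_of_repeat (h : D.IsMarkedGraph T rank) {l m r : List Flip}
    {s : Flip} (hp : FlipPath T (l ++ s :: (m ++ s :: r)) T') (hs : s ∈ D.flips)
    (hm : ∀ t ∈ m, t ∈ D.flips) : ∃ c ∈ m, (s, c) ∈ D.child := by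
  obtain ⟨T₁, -, hp⟩ := flipPath_append.1 hp
  obtain ⟨T₂, hs₁, hp⟩ := flipPath_cons.1 hp
  obtain ⟨T₃, hp, hp₃⟩ := flipPath_append.1 hp
  obtain ⟨T₄, hs₃, -⟩ := flipPath_cons.1 hp₃
  obtain ⟨τ, hτ⟩ := s.removed_nonempty
  have hτ₂ : τ ∉ T₂ := by
    rw [(performs_iff.1 hs₁).2.2]
    rintro (hτ₁ | hτs)
    · exact hτ₁.2 hτ
    · exact Set.disjoint_left.1 (h.disjoint_created_removed hs hs (h.not_below_self s)) hτs hτ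
  obtain ⟨c, hc, hτc⟩ := (hp.mem_or_mem_created ((performs_iff.1 hs₃).2.1 hτ)).resolve_left hτ₂
  exact ⟨c, hc, h.child_of_mem_created_of_mem_removed (hm c hc) hs hτc hτ⟩

theorem not_flipPath_of_repeat (h : D.IsMarkedGraph T rank) {l m r : List Flip} {s : Flip}
    (hD : ∀ t ∈ l ++ s :: (m ++ s :: r), t ∈ D.flips) :
    ¬ FlipPath T (l ++ s :: (m ++ s :: r)) T' := by
  induction hn : rank s using Nat.strong_induction_on generalizing s l m r with
  | _ n ih =>
    intro hp
    obtain ⟨c, hcm, hcs⟩ := h.exists_child_mem_of_flipPath_of_repeat hp (hD s (by simp))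
      fun t ht => hD t (by simp [ht])
    have hcl := h.child_mem_of_flipPath hp (fun t ht => hD t (by simp [ht])) hcs
    obtain ⟨l₁, l₂, rfl⟩ := List.append_of_mem hcl
    obtain ⟨m₁, m₂, rfl⟩ := List.append_of_mem hcm
    have hassoc : (l₁ ++ c :: l₂) ++ s :: ((m₁ ++ c :: m₂) ++ s :: r) =
        l₁ ++ c :: ((l₂ ++ s :: m₁) ++ c :: (m₂ ++ s :: r)) := by simp
    rw [hassoc] at hp hD
    exact ih _ (hn ▸ h.child_rank _ _ hcs) hD rfl hp

theorem isLinearOrdering_of_flipPath (h : D.IsMarkedGraph T rank) {l : List Flip}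
    (hp : FlipPath T l T') (hl : ∀ s, s ∈ l ↔ s ∈ D.flips) : D.IsLinearOrdering l := by
  have hnodup : l.Nodup := by
    refine List.nodup_iff_sublist.2 fun s hs => ?_
    obtain ⟨l, m, r, rfl⟩ := exists_eq_append_of_pair_sublist hs
    exact h.not_flipPath_of_repeat (fun t => (hl t).1) hp
  refine ⟨hnodup, hl, List.pairwise_iff_forall_sublist.2 fun {s t} hst hts => ?_⟩
  obtain ⟨l, m, r, rfl⟩ := exists_eq_append_of_pair_sublist hst
  have ht : t ∈ l := h.mem_of_below_of_flipPath hts hp fun t ht => (hl t).1 (by simp [ht])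
  exact (List.nodup_append.1 hnodup).2.2 t ht t (by simp) rfl

theorem isFlipPlan (h : D.IsMarkedGraph T rank) {E : Set (Sym2 Pt)}
    (hE : ∀ l T', D.IsLinearOrdering l → FlipPath T l T' → E ⊆ edges T') : IsFlipPlan D T E := by
  refine ⟨h.not_below_self, fun l => ⟨fun hl => ?_, fun ⟨⟨_, hp, _⟩, hl⟩ =>
    h.isLinearOrdering_of_flipPath hp hl⟩⟩
  have hp := h.flipPath_of_isLinearOrdering hl
  exact ⟨⟨_, hp, hE _ _ hl hp⟩, hl.2.1⟩

end FlipPoset.IsMarkedGraph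

/-! ### Bases reached by mediant steps -/

section Side

variable {M : Type*} [AddCommMonoid M]

/-- The pair of vectors reached from `(P, Q)` by a list of mediant steps, last step first; the
first vector has index `true`. The step `t` keeps the vector with index `t` and replaces the other
one by the sum of both. In the triangular lattice these are the sides of the Farey parallelograms
along a path in the Stern-Brocot tree. -/
def side (P Q : M) : List Bool → Bool → M
  | [], i => if i then P else Q
  | t :: L, i => if i = t then side P Q L t else side P Q L t + side P Q L !t

/-- The sum of the two vectors reached by a list of mediant steps: the diagonal of the
parallelogram that they span. -/
def diagonal (P Q : M) (L : List Bool) : M := side P Q L true + side P Q L false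

theorem diagonal_eq_add_side (P Q : M) (L : List Bool) (i : Bool) :
    diagonal P Q L = side P Q L i + side P Q L !i := by
  cases i
  · exact add_comm _ _
  · rfl

theorem side_cons_self (P Q : M) (t : Bool) (L : List Bool) :
    side P Q (t :: L) t = side P Q L t := if_pos rfl

theorem side_cons_not (P Q : M) (t : Bool) (L : List Bool) :
    side P Q (t :: L) (!t) = diagonal P Q L := by
  rw [side, if_neg (Bool.not_ne_self t), diagonal_eq_add_side P Q L t]

theorem diagonal_cons (P Q : M) (t : Bool) (L : List Bool) :
    diagonal P Q (t :: L) = side P Q L t + diagonal P Q L := by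
  rw [diagonal_eq_add_side P Q (t :: L) t, side_cons_self, side_cons_not]

theorem map_side {N : Type*} [AddCommMonoid N] (f : M →+ N) (P Q : M) (L : List Bool) (i : Bool) :
    side (f P) (f Q) L i = f (side P Q L i) := by
  induction L generalizing i with
  | nil => cases i <;> rfl
  | cons t L ih => simp only [side, ih, apply_ite f, map_add]

theorem side_eq_of_side_cons_eq [IsCancelAdd M] {P Q : M} {t : Bool} {L L' : List Bool}
    (h : side P Q (t :: L) = side P Q (t :: L')) : side P Q L = side P Q L' := by
  have hkept := congrFun h t
  have hsum := congrFun h !t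
  rw [side_cons_self, side_cons_self] at hkept
  rw [side_cons_not, side_cons_not, diagonal_eq_add_side P Q L t, diagonal_eq_add_side P Q L' t,
    hkept, add_right_inj] at hsum
  funext i
  rcases Bool.eq_or_eq_not i t with rfl | rfl
  · exact hkept
  · exact hsum

end Side

/-! ### Flips on parallelograms -/

/-- The flip on the parallelogram at `u` spanned by the vectors reached by `L`. -/
def parallelogramFlip (P Q : Pt) (L : List Bool) (u : Pt) : Flip :=
  ⟨s(u + side P Q L true, u + side P Q L false), s(u, u + diagonal P Q L)⟩

/-- The triangles removed by `parallelogramFlip`; the one with index `true` contains `u`. -/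
def oldHalf (P Q : Pt) (L : List Bool) (u : Pt) (i : Bool) : Finset Pt :=
  {if i then u else u + diagonal P Q L, u + side P Q L true, u + side P Q L false}

/-- The triangles created by `parallelogramFlip`, indexed by the side at `u` that they contain. -/
def newHalf (P Q : Pt) (L : List Bool) (u : Pt) (i : Bool) : Finset Pt :=
  {u, u + side P Q L i, u + diagonal P Q L}

/-- The points at which the flips with path `L` must precede the flip with path `t :: L` at `u`. -/
def childPoint (P Q : Pt) (t : Bool) (L : List Bool) (u : Pt) (i : Bool) : Pt :=
  if i then u else u + side P Q L t

theorem mem_removed_parallelogramFlip {P Q : Pt} {L : List Bool} {u : Pt} {τ : Finset Pt} :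
    τ ∈ (parallelogramFlip P Q L u).removed ↔ ∃ i, τ = oldHalf P Q L u i := by
  rw [parallelogramFlip, Flip.removed_mk, Bool.exists_bool, or_comm]
  simp only [oldHalf, Set.mem_insert_iff, Set.mem_singleton_iff, if_true, Bool.false_eq_true,
    if_false]
  rw [Finset.insert_comm u, Finset.insert_comm (u + diagonal P Q L),
    Finset.pair_comm (u + diagonal P Q L)]

theorem mem_created_parallelogramFlip {P Q : Pt} {L : List Bool} {u : Pt} {τ : Finset Pt} :
    τ ∈ (parallelogramFlip P Q L u).created ↔ ∃ i, τ = newHalf P Q L u i := by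
  rw [parallelogramFlip, Flip.created_mk, Bool.exists_bool, or_comm]
  simp only [newHalf, Set.mem_insert_iff, Set.mem_singleton_iff]
  rw [Finset.insert_comm (u + side P Q L true)]

theorem oldHalf_cons (P Q : Pt) (t : Bool) (L : List Bool) (u : Pt) (i : Bool) :
    oldHalf P Q (t :: L) u i = newHalf P Q L (childPoint P Q t L u i) (t == i) := by
  have hsides : ({u + side P Q (t :: L) true, u + side P Q (t :: L) false} : Finset Pt) =
      {u + side P Q L t, u + diagonal P Q L} := by
    cases t
    · rw [side_cons_self, ← Bool.not_false, side_cons_not, Finset.pair_comm]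
    · rw [side_cons_self, ← Bool.not_true, side_cons_not]
  rw [oldHalf, newHalf, hsides, diagonal_cons]
  cases i
  · simp only [childPoint, Bool.false_eq_true, if_false, beq_false, add_assoc,
      ← diagonal_eq_add_side P Q L t]
    rw [Finset.insert_comm (u + (_ + _)), Finset.pair_comm (u + (_ + _))]
  · simp only [childPoint, if_true, beq_true]

theorem emb_add (p q : Pt) : emb (p + q) = emb p + emb q := by
  simp only [emb, Prod.fst_add, Prod.snd_add, Int.cast_add]
  ring

theorem isConvex_parallelogramFlip (P Q : Pt) (L : List Bool) (u : Pt) :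
    (parallelogramFlip P Q L u).IsConvex := by
  have hmid : ∀ x y : ℂ, midpoint ℝ x y ∈ openSegment ℝ x y := fun x y =>
    ⟨1 / 2, 1 / 2, by norm_num, by norm_num, by norm_num, by
      rw [midpoint_eq_smul_add, smul_add, invOf_eq_inv, one_div]⟩
  have hcenter : midpoint ℝ (emb (u + side P Q L true)) (emb (u + side P Q L false)) =
      midpoint ℝ (emb u) (emb (u + diagonal P Q L)) := by
    simp only [midpoint_eq_smul_add, diagonal, emb_add]
    congr 1
    ring
  exact ⟨_, _, _, _, rfl, rfl, _, hmid _ _, hcenter ▸ hmid _ _⟩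

/-! ### Coordinates with respect to a lattice basis -/

/-- The determinant of two lattice vectors in their integer coordinates. -/
def det (a b : Pt) : ℤ := a.1 * b.2 - a.2 * b.1

theorem det_add_left (a b c : Pt) : det (a + b) c = det a c + det b c := by
  simp only [det, Prod.fst_add, Prod.snd_add]
  ring

theorem det_add_right (a b c : Pt) : det a (b + c) = det a b + det a c := by
  simp only [det, Prod.fst_add, Prod.snd_add]
  ring

theorem det_swap (a b : Pt) : det b a = - det a b := by
  simp only [det]
  ring

/-- The first coordinate with respect to a lattice basis `P`, `Q`, by Cramer's rule; the
determinant is `±1`, so multiplying by it is dividing by it. -/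
def fstCoord (P Q : Pt) : Pt →+ ℤ :=
  AddMonoidHom.mk' (fun z => det P Q * det z Q) fun a b => by rw [det_add_left, mul_add]

/-- The second coordinate with respect to a lattice basis `P`, `Q`. -/
def sndCoord (P Q : Pt) : Pt →+ ℤ :=
  AddMonoidHom.mk' (fun z => det P Q * det P z) fun a b => by rw [det_add_right, mul_add]

/-- The sum of the coordinates with respect to a lattice basis `P`, `Q`. -/
def height (P Q : Pt) : Pt →+ ℤ := fstCoord P Q + sndCoord P Q

/-- `P` and `Q` form a basis of the lattice. -/
def IsLatticeBasis (P Q : Pt) : Prop := det P Q * det P Q = 1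

theorem fstCoord_apply (P Q z : Pt) : fstCoord P Q z = det P Q * det z Q := rfl

theorem sndCoord_apply (P Q z : Pt) : sndCoord P Q z = det P Q * det P z := rfl

theorem height_apply (P Q z : Pt) : height P Q z = fstCoord P Q z + sndCoord P Q z := rfl

theorem fstCoord_right (P Q : Pt) : fstCoord P Q Q = 0 := by
  rw [fstCoord_apply, det, det]
  ring

theorem sndCoord_left (P Q : Pt) : sndCoord P Q P = 0 := by
  rw [sndCoord_apply, det, det]
  ring

theorem det_side (P Q : Pt) (L : List Bool) :
    det (side P Q L true) (side P Q L false) = det P Q := by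
  induction L with
  | nil => rfl
  | cons t L ih =>
    rw [← ih]
    cases t <;> simp only [side, det, Bool.not_true, Bool.not_false, if_true, Bool.true_eq_false,
      Bool.false_eq_true, if_false, Prod.fst_add, Prod.snd_add] <;> ring

theorem triple_eq_of_strictMono {α β : Type*} [DecidableEq α] [LinearOrder β] (f : α → β)
    {x y z x' y' z' : α} (h : ({x, y, z} : Finset α) = {x', y', z'}) (hxy : f x < f y)
    (hyz : f y < f z) (hxy' : f x' < f y') (hyz' : f y' < f z') : x = x' ∧ y = y' ∧ z = z' := by
  have hx : x ∈ ({x', y', z'} : Finset α) := by rw [← h]; simp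
  have hy : y ∈ ({x', y', z'} : Finset α) := by rw [← h]; simp
  have hz : z ∈ ({x', y', z'} : Finset α) := by rw [← h]; simp
  simp only [Finset.mem_insert, Finset.mem_singleton] at hx hy hz
  grind

namespace IsLatticeBasis

variable {P Q : Pt} (h : IsLatticeBasis P Q)

include h

theorem fstCoord_left : fstCoord P Q P = 1 := h

theorem sndCoord_right : sndCoord P Q Q = 1 := h

theorem height_left : height P Q P = 1 := by
  rw [height_apply, h.fstCoord_left, sndCoord_left, add_zero]

theorem height_right : height P Q Q = 1 := by
  rw [height_apply, h.sndCoord_right, fstCoord_right, zero_add]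

theorem height_side_pos (L : List Bool) (i : Bool) : 0 < height P Q (side P Q L i) := by
  induction L generalizing i with
  | nil => cases i <;> simp [side, h.height_left, h.height_right]
  | cons t L ih =>
    rw [side]
    split_ifs
    · exact ih t
    · rw [map_add]
      exact add_pos (ih t) (ih !t)

theorem height_side_lt_height_diagonal (L : List Bool) (i : Bool) :
    height P Q (side P Q L i) < height P Q (diagonal P Q L) := by
  rw [diagonal_eq_add_side P Q L i, map_add]
  exact lt_add_of_pos_right _ (h.height_side_pos L !i)

theorem one_lt_height_diagonal (L : List Bool) : 1 < height P Q (diagonal P Q L) :=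
  (h.height_side_pos L true).trans_lt (h.height_side_lt_height_diagonal L true)

theorem height_diagonal_lt_cons (t : Bool) (L : List Bool) :
    height P Q (diagonal P Q L) < height P Q (diagonal P Q (t :: L)) := by
  rw [diagonal_cons, map_add]
  exact lt_add_of_pos_left _ (h.height_side_pos L t)

theorem two_lt_height_diagonal_cons (t : Bool) (L : List Bool) :
    2 < height P Q (diagonal P Q (t :: L)) :=
  (h.one_lt_height_diagonal L).trans_lt (h.height_diagonal_lt_cons t L)

theorem height_side_cons_lt (t : Bool) (L : List Bool) :
    height P Q (side P Q (t :: L) t) < height P Q (side P Q (t :: L) !t) := by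
  rw [side_cons_self, side_cons_not]
  exact h.height_side_lt_height_diagonal L t

theorem side_cons_ne_side_cons_not (t : Bool) (L L' : List Bool) :
    side P Q (t :: L) ≠ side P Q ((!t) :: L') := by
  intro heq
  have hlt := h.height_side_cons_lt t L
  have hgt := h.height_side_cons_lt (!t) L'
  rw [Bool.not_not, ← heq] at hgt
  exact hlt.asymm hgt

theorem side_injective : Function.Injective (side P Q) := by
  have hnil : height P Q (diagonal P Q []) = 2 := by
    simp [diagonal, side, h.height_left, h.height_right]
  have hne : ∀ t L, side P Q (t :: L) ≠ side P Q [] := fun t L heq => by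
    have hlt := h.two_lt_height_diagonal_cons t L
    rw [diagonal, heq, ← diagonal, hnil] at hlt
    exact lt_irrefl _ hlt
  intro L L' heq
  induction L generalizing L' with
  | nil =>
    cases L' with
    | nil => rfl
    | cons t' L' => exact absurd heq.symm (hne t' L')
  | cons t L ih =>
    cases L' with
    | nil => exact absurd heq (hne t L)
    | cons t' L' =>
      rcases Bool.eq_or_eq_not t' t with rfl | rfl
      · rw [ih (side_eq_of_side_cons_eq heq)]
      · exact absurd heq (h.side_cons_ne_side_cons_not t L L')

theorem side_ne_swap (L L' : List Bool) : ¬ ∀ i, side P Q L i = side P Q L' !i := by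
  intro hswap
  have hdet : det P Q = - det P Q := by
    conv_lhs => rw [← det_side P Q L, hswap, hswap]
    rw [Bool.not_true, Bool.not_false, det_swap, det_side]
  have hzero : det P Q = 0 := by omega
  simp [IsLatticeBasis, hzero] at h

theorem newHalf_inj {L L' : List Bool} {u u' : Pt} {i i' : Bool}
    (heq : newHalf P Q L u i = newHalf P Q L' u' i') : L = L' ∧ u = u' ∧ i = i' := by
  have hlt : ∀ L u i, height P Q u < height P Q (u + side P Q L i) ∧
      height P Q (u + side P Q L i) < height P Q (u + diagonal P Q L) := fun L u i => by
    simpa only [map_add, lt_add_iff_pos_right, add_lt_add_iff_left] using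
      ⟨h.height_side_pos L i, h.height_side_lt_height_diagonal L i⟩
  obtain ⟨rfl, hside, hdiag⟩ := triple_eq_of_strictMono (height P Q) heq (hlt L u i).1 (hlt L u i).2
    (hlt L' u' i').1 (hlt L' u' i').2
  have hside : side P Q L i = side P Q L' i' := add_left_cancel hside
  have hother : side P Q L (!i) = side P Q L' (!i') := by
    rw [add_right_inj, diagonal_eq_add_side P Q L i, diagonal_eq_add_side P Q L' i', hside] at hdiag
    exact add_left_cancel hdiag
  rcases Bool.eq_or_eq_not i i' with rfl | rfl
  · refine ⟨h.side_injective (funext fun j => ?_), rfl, rfl⟩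
    rcases Bool.eq_or_eq_not j i with rfl | rfl
    · exact hside
    · exact hother
  · refine absurd (fun j => ?_) (h.side_ne_swap L L')
    rcases Bool.eq_or_eq_not j i' with rfl | rfl
    · rwa [Bool.not_not] at hother
    · rwa [Bool.not_not]

theorem parallelogramFlip_inj {L L' : List Bool} {u u' : Pt}
    (heq : parallelogramFlip P Q L u = parallelogramFlip P Q L' u') : L = L' ∧ u = u' := by
  have hmem : newHalf P Q L u true ∈ (parallelogramFlip P Q L' u').created :=
    heq ▸ mem_created_parallelogramFlip.2 ⟨true, rfl⟩
  obtain ⟨i, hi⟩ := mem_created_parallelogramFlip.1 hmem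
  obtain ⟨hL, hu, -⟩ := h.newHalf_inj hi
  exact ⟨hL, hu⟩

theorem oldHalf_nil_inj {u u' : Pt} {i i' : Bool}
    (heq : oldHalf P Q [] u i = oldHalf P Q [] u' i') : u = u' := by
  -- `f` orders the vertices of a lattice unit triangle: its values at `0, P, Q, P + Q` are
  -- `0, 1, 2, 3`.
  let f : Pt →+ ℤ := fstCoord P Q + 2 • sndCoord P Q
  have hfP : f P = 1 := by
    simp [f, h.fstCoord_left, sndCoord_left]
  have hfQ : f Q = 2 := by
    simp [f, h.sndCoord_right, fstCoord_right]
  have hmixed : ∀ {u u' : Pt}, oldHalf P Q [] u true ≠ oldHalf P Q [] u' false := by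
    intro u u' heq
    simp only [oldHalf, side, diagonal, if_true, Bool.false_eq_true, if_false] at heq
    rw [Finset.insert_comm (u' + (P + Q)), Finset.pair_comm (u' + (P + Q))] at heq
    obtain ⟨hu, hP, -⟩ := triple_eq_of_strictMono f heq (by simp [hfP]) (by simp [hfP, hfQ])
      (by simp [hfP, hfQ]) (by simp [hfP, hfQ])
    have hQ := congrArg (sndCoord P Q) hP
    simp [hu, sndCoord_left, h.sndCoord_right] at hQ
  cases i <;> cases i'
  · simp only [oldHalf, side, diagonal, if_true, Bool.false_eq_true, if_false] at heq
    rw [Finset.insert_comm (u + (P + Q)), Finset.pair_comm (u + (P + Q)),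
      Finset.insert_comm (u' + (P + Q)), Finset.pair_comm (u' + (P + Q))] at heq
    exact add_right_cancel (triple_eq_of_strictMono f heq (by simp [hfP, hfQ])
      (by simp [hfP, hfQ]) (by simp [hfP, hfQ]) (by simp [hfP, hfQ])).1
  · exact absurd heq.symm hmixed
  · exact absurd heq hmixed
  · simp only [oldHalf, side, if_true, Bool.false_eq_true, if_false] at heq
    exact (triple_eq_of_strictMono f heq (by simp [hfP]) (by simp [hfP, hfQ])
      (by simp [hfP]) (by simp [hfP, hfQ])).1

end IsLatticeBasis

/-! ### Plans as flip posets -/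

/-- In the plan for the flip at `v` with path `L`, there is a flip at `u` with path `L'`. -/
inductive IsDescendant (P Q : Pt) (L : List Bool) (v : Pt) : List Bool → Pt → Prop
  | root : IsDescendant P Q L v L v
  | child {t : Bool} {L' : List Bool} {u : Pt} (h : IsDescendant P Q L v (t :: L') u) (i : Bool) :
      IsDescendant P Q L v L' (childPoint P Q t L' u i)

theorem IsDescendant.isSuffix {P Q : Pt} {L L' : List Bool} {v u : Pt}
    (h : IsDescendant P Q L v L' u) : L' <:+ L := by
  induction h with
  | root => exact List.suffix_rfl
  | child _ _ ih => exact (List.suffix_cons _ _).trans ih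

theorem isDescendant_nil_iff {P Q : Pt} {L : List Bool} {v u : Pt} :
    IsDescendant P Q [] v L u ↔ L = [] ∧ u = v := by
  constructor
  · intro h
    cases h with
    | root => exact ⟨rfl, rfl⟩
    | child h _ => exact absurd (List.suffix_nil.1 h.isSuffix) (List.cons_ne_nil _ _)
  · rintro ⟨rfl, rfl⟩
    exact .root

theorem isDescendant_cons_iff {P Q : Pt} {t : Bool} {L L' : List Bool} {v u : Pt} :
    IsDescendant P Q (t :: L) v L' u ↔
      (L' = t :: L ∧ u = v) ∨ ∃ i, IsDescendant P Q L (childPoint P Q t L v i) L' u := by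
  constructor
  · intro h
    induction h with
    | root => exact Or.inl ⟨rfl, rfl⟩
    | child _ j ih =>
      rcases ih with ⟨hL, rfl⟩ | ⟨i, h⟩
      · cases hL
        exact Or.inr ⟨j, .root⟩
      · exact Or.inr ⟨i, h.child j⟩
  · rintro (⟨rfl, rfl⟩ | ⟨i, h⟩)
    · exact .root
    · induction h with
      | root => exact .child .root i
      | child _ j ih => exact ih.child j

/-- The output of Algorithm Flip Plan for the flip at `v` with path `L`, as an explicit recursion
on the path. -/
def plan (P Q : Pt) : List Bool → Pt → FlipPoset
  | [], v => ⟨{parallelogramFlip P Q [] v}, ∅⟩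
  | t :: L, v =>
    let D := plan P Q L v
    let D' := plan P Q L (v + side P Q L t)
    ⟨{parallelogramFlip P Q (t :: L) v} ∪ (D.flips ∪ D'.flips),
      {(parallelogramFlip P Q (t :: L) v, parallelogramFlip P Q L v),
        (parallelogramFlip P Q (t :: L) v, parallelogramFlip P Q L (v + side P Q L t))} ∪
        (D.child ∪ D'.child)⟩

/-- `D` is the union of the plans for the flips with path `L` at the points of `S`. -/
structure FlipPoset.HasRoots (D : FlipPoset) (P Q : Pt) (L : List Bool) (S : Set Pt) : Prop where
  mem_flips_iff : ∀ s, s ∈ D.flips ↔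
    ∃ v ∈ S, ∃ L' u, IsDescendant P Q L v L' u ∧ s = parallelogramFlip P Q L' u
  mem_child_iff : ∀ s c, (s, c) ∈ D.child ↔
    ∃ v ∈ S, ∃ t L' u, IsDescendant P Q L v (t :: L') u ∧ s = parallelogramFlip P Q (t :: L') u ∧
      ∃ i, c = parallelogramFlip P Q L' (childPoint P Q t L' u i)

theorem mem_flips_plan_iff {P Q : Pt} {L : List Bool} {v : Pt} {s : Flip} :
    s ∈ (plan P Q L v).flips ↔
      ∃ L' u, IsDescendant P Q L v L' u ∧ s = parallelogramFlip P Q L' u := by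
  induction L generalizing v with
  | nil =>
    rw [plan, Finset.mem_singleton]
    constructor
    · rintro rfl
      exact ⟨[], v, .root, rfl⟩
    · rintro ⟨L', u, hu, rfl⟩
      obtain ⟨rfl, rfl⟩ := isDescendant_nil_iff.1 hu
      rfl
  | cons t L ih =>
    simp only [plan, Finset.mem_union, Finset.mem_singleton, ih]
    constructor
    · rintro (rfl | ⟨L', u, hu, rfl⟩ | ⟨L', u, hu, rfl⟩)
      · exact ⟨t :: L, v, .root, rfl⟩
      · exact ⟨L', u, isDescendant_cons_iff.2 (Or.inr ⟨true, hu⟩), rfl⟩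
      · exact ⟨L', u, isDescendant_cons_iff.2 (Or.inr ⟨false, hu⟩), rfl⟩
    · rintro ⟨L', u, hu, rfl⟩
      rcases isDescendant_cons_iff.1 hu with ⟨rfl, rfl⟩ | ⟨_ | _, hu⟩
      · exact Or.inl rfl
      · exact Or.inr (Or.inr ⟨L', u, hu, rfl⟩)
      · exact Or.inr (Or.inl ⟨L', u, hu, rfl⟩)

theorem mem_child_plan_iff {P Q : Pt} {L : List Bool} {v : Pt} {s c : Flip} :
    (s, c) ∈ (plan P Q L v).child ↔
      ∃ t L' u, IsDescendant P Q L v (t :: L') u ∧ s = parallelogramFlip P Q (t :: L') u ∧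
        ∃ i, c = parallelogramFlip P Q L' (childPoint P Q t L' u i) := by
  induction L generalizing v with
  | nil =>
    refine ⟨fun hmem => absurd hmem (Finset.notMem_empty _), ?_⟩
    rintro ⟨t, L', u, hu, -⟩
    exact absurd (isDescendant_nil_iff.1 hu).1 (List.cons_ne_nil t L')
  | cons t L ih =>
    simp only [plan, Finset.mem_union, Finset.mem_insert, Finset.mem_singleton, Prod.mk.injEq, ih]
    constructor
    · rintro ((⟨rfl, rfl⟩ | ⟨rfl, rfl⟩) | ⟨t', L', u, hu, h⟩ | ⟨t', L', u, hu, h⟩)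
      · exact ⟨t, L, v, .root, rfl, true, rfl⟩
      · exact ⟨t, L, v, .root, rfl, false, rfl⟩
      · exact ⟨t', L', u, isDescendant_cons_iff.2 (Or.inr ⟨true, hu⟩), h⟩
      · exact ⟨t', L', u, isDescendant_cons_iff.2 (Or.inr ⟨false, hu⟩), h⟩
    · rintro ⟨t', L', u, hu, rfl, i, rfl⟩
      rcases isDescendant_cons_iff.1 hu with ⟨hL, rfl⟩ | ⟨_ | _, hu⟩
      · obtain ⟨rfl, rfl⟩ := List.cons.inj hL
        cases i
        · exact Or.inl (Or.inr ⟨rfl, rfl⟩)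
        · exact Or.inl (Or.inl ⟨rfl, rfl⟩)
      · exact Or.inr (Or.inr ⟨t', L', u, hu, rfl, i, rfl⟩)
      · exact Or.inr (Or.inl ⟨t', L', u, hu, rfl, i, rfl⟩)

theorem hasRoots_plan (P Q : Pt) (L : List Bool) (v : Pt) :
    (plan P Q L v).HasRoots P Q L {v} := by
  constructor
  · simp only [Set.mem_singleton_iff, exists_eq_left]
    exact fun _ => mem_flips_plan_iff
  · simp only [Set.mem_singleton_iff, exists_eq_left]
    exact fun _ _ => mem_child_plan_iff

theorem FlipPoset.HasRoots.union {D D' : FlipPoset} {P Q : Pt} {L : List Bool} {S S' : Set Pt}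
    (h : D.HasRoots P Q L S) (h' : D'.HasRoots P Q L S') :
    (D.union D').HasRoots P Q L (S ∪ S') := by
  constructor
  · intro s
    simp only [FlipPoset.union, Finset.mem_union, h.mem_flips_iff, h'.mem_flips_iff,
      Set.mem_union, or_and_right, exists_or]
  · intro s c
    simp only [FlipPoset.union, Finset.mem_union, h.mem_child_iff, h'.mem_child_iff,
      Set.mem_union, or_and_right, exists_or]

/-- The difference of the heights of the endpoints of the edge that `s` creates. -/
def Flip.rank (P Q : Pt) (s : Flip) : ℕ :=
  Sym2.lift ⟨fun a b => (height P Q a - height P Q b).natAbs, fun a b => by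
    simp only; omega⟩ s.new

namespace IsLatticeBasis

variable {P Q : Pt} (h : IsLatticeBasis P Q)

include h

theorem rank_parallelogramFlip (L : List Bool) (u : Pt) :
    ((parallelogramFlip P Q L u).rank P Q : ℤ) = height P Q (diagonal P Q L) := by
  have hpos := h.one_lt_height_diagonal L
  have hrank : (parallelogramFlip P Q L u).rank P Q =
    (height P Q u - height P Q (u + diagonal P Q L)).natAbs := rfl
  rw [hrank, map_add]
  omega

theorem newHalf_notMem {T : Set (Finset Pt)}
    (hT : ∀ t ∈ T, ∀ a ∈ t, ∀ b ∈ t, height P Q a ≤ height P Q b + 1) (L : List Bool) (u : Pt)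
    (i : Bool) : newHalf P Q L u i ∉ T := by
  intro hmem
  have hle := hT _ hmem (u + diagonal P Q L) (by simp [newHalf]) u (by simp [newHalf])
  have hpos := h.one_lt_height_diagonal L
  rw [map_add] at hle
  omega

theorem oldHalf_cons_inj {t t' : Bool} {L₁ L₂ L : List Bool} (h₁ : t :: L₁ <:+ L)
    (h₂ : t' :: L₂ <:+ L) {u u' : Pt} {i i' : Bool}
    (heq : oldHalf P Q (t :: L₁) u i = oldHalf P Q (t' :: L₂) u' i') :
    t :: L₁ = t' :: L₂ ∧ u = u' := by
  rw [oldHalf_cons, oldHalf_cons] at heq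
  obtain ⟨rfl, hpoint, hside⟩ := h.newHalf_inj heq
  obtain rfl : t = t' := by
    have hsuffix := List.suffix_of_suffix_length_le h₁ h₂ le_rfl
    exact (List.cons.inj (hsuffix.eq_of_length rfl)).1
  obtain rfl : i = i' := by cases t <;> simpa using hside
  refine ⟨rfl, ?_⟩
  cases i
  · exact add_right_cancel hpoint
  · exact hpoint

theorem oldHalf_inj {L₁ L₂ L : List Bool} (h₁ : L₁ <:+ L) (h₂ : L₂ <:+ L) {u u' : Pt}
    {i i' : Bool} {T : Set (Finset Pt)}
    (hT : ∀ t ∈ T, ∀ a ∈ t, ∀ b ∈ t, height P Q a ≤ height P Q b + 1)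
    (hmem₁ : L₁ = [] → oldHalf P Q [] u i ∈ T) (hmem₂ : L₂ = [] → oldHalf P Q [] u' i' ∈ T)
    (heq : oldHalf P Q L₁ u i = oldHalf P Q L₂ u' i') : L₁ = L₂ ∧ u = u' := by
  cases L₁ with
  | nil =>
    cases L₂ with
    | nil => exact ⟨rfl, h.oldHalf_nil_inj heq⟩
    | cons t₂ L₂ =>
      rw [oldHalf_cons] at heq
      exact absurd (heq ▸ hmem₁ rfl) (h.newHalf_notMem hT _ _ _)
  | cons t₁ L₁ =>
    cases L₂ with
    | nil =>
      rw [oldHalf_cons] at heq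
      exact absurd (heq.symm ▸ hmem₂ rfl) (h.newHalf_notMem hT _ _ _)
    | cons t₂ L₂ => exact h.oldHalf_cons_inj h₁ h₂ heq

theorem eq_of_mem_removed {D : FlipPoset} {L : List Bool} {S : Set Pt} {T : Set (Finset Pt)}
    (hD : D.HasRoots P Q L S) (hT : ∀ t ∈ T, ∀ a ∈ t, ∀ b ∈ t, height P Q a ≤ height P Q b + 1)
    (hleaf : ∀ v ∈ S, ∀ u i, IsDescendant P Q L v [] u → oldHalf P Q [] u i ∈ T) {s t : Flip}
    (hs : s ∈ D.flips) (ht : t ∈ D.flips) {τ : Finset Pt} (hτs : τ ∈ s.removed)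
    (hτt : τ ∈ t.removed) : s = t := by
  obtain ⟨v, hv, L₁, u, hu, rfl⟩ := (hD.mem_flips_iff s).1 hs
  obtain ⟨v', hv', L₂, u', hu', rfl⟩ := (hD.mem_flips_iff t).1 ht
  obtain ⟨i, rfl⟩ := mem_removed_parallelogramFlip.1 hτs
  obtain ⟨i', heq⟩ := mem_removed_parallelogramFlip.1 hτt
  obtain ⟨rfl, rfl⟩ := h.oldHalf_inj hu.isSuffix hu'.isSuffix hT
    (by rintro rfl; exact hleaf v hv u i hu) (by rintro rfl; exact hleaf v' hv' u' i' hu') heq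
  rfl

theorem isMarkedGraph {D : FlipPoset} {L : List Bool} {S : Set Pt} {T : Set (Finset Pt)}
    (hD : D.HasRoots P Q L S) (hT : ∀ t ∈ T, ∀ a ∈ t, ∀ b ∈ t, height P Q a ≤ height P Q b + 1)
    (hleaf : ∀ v ∈ S, ∀ u i, IsDescendant P Q L v [] u → oldHalf P Q [] u i ∈ T) :
    D.IsMarkedGraph T (Flip.rank P Q) where
  convex s hs := by
    obtain ⟨v, -, L', u, -, rfl⟩ := (hD.mem_flips_iff s).1 hs
    exact isConvex_parallelogramFlip ..
  removed_inj s hs t ht τ := h.eq_of_mem_removed hD hT hleaf hs ht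
  created_inj s hs t ht τ hτs hτt := by
    obtain ⟨v, -, L₁, u, -, rfl⟩ := (hD.mem_flips_iff s).1 hs
    obtain ⟨v', -, L₂, u', hu', rfl⟩ := (hD.mem_flips_iff t).1 ht
    obtain ⟨i, rfl⟩ := mem_created_parallelogramFlip.1 hτs
    obtain ⟨i', heq⟩ := mem_created_parallelogramFlip.1 hτt
    obtain ⟨rfl, rfl, -⟩ := h.newHalf_inj heq
    rfl
  created_notMem s hs τ hτs := by
    obtain ⟨v, -, L', u, -, rfl⟩ := (hD.mem_flips_iff s).1 hs
    obtain ⟨i, rfl⟩ := mem_created_parallelogramFlip.1 hτs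
    exact h.newHalf_notMem hT L' u i
  removed_mem s hs τ hτs := by
    obtain ⟨v, hv, L', u, hu, rfl⟩ := (hD.mem_flips_iff s).1 hs
    obtain ⟨i, rfl⟩ := mem_removed_parallelogramFlip.1 hτs
    cases L' with
    | nil => exact Or.inl (hleaf v hv u i hu)
    | cons t L' =>
      exact Or.inr ⟨_, (hD.mem_child_iff _ _).2 ⟨v, hv, t, L', u, hu, rfl, i, rfl⟩,
        mem_created_parallelogramFlip.2 ⟨_, oldHalf_cons ..⟩⟩
  child_mem s c hc := by
    obtain ⟨v, hv, t, L', u, hu, rfl, i, rfl⟩ := (hD.mem_child_iff s c).1 hc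
    exact ⟨(hD.mem_flips_iff _).2 ⟨v, hv, _, _, hu, rfl⟩,
      (hD.mem_flips_iff _).2 ⟨v, hv, _, _, hu.child i, rfl⟩⟩
  child_rank s c hc := by
    obtain ⟨v, -, t, L', u, -, rfl, i, rfl⟩ := (hD.mem_child_iff s c).1 hc
    zify
    rw [h.rank_parallelogramFlip, h.rank_parallelogramFlip]
    exact h.height_diagonal_lt_cons t L'
  child_created s c hc := by
    obtain ⟨v, -, t, L', u, -, rfl, i, rfl⟩ := (hD.mem_child_iff s c).1 hc
    exact ⟨oldHalf P Q (t :: L') u i, mem_removed_parallelogramFlip.2 ⟨i, rfl⟩,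
      mem_created_parallelogramFlip.2 ⟨_, oldHalf_cons ..⟩⟩

theorem newHalf_mem_of_flipPath {D : FlipPoset} {L : List Bool} {S : Set Pt}
    {T T' : Set (Finset Pt)} {rank : Flip → ℕ} (hD : D.HasRoots P Q L S)
    (hmarked : D.IsMarkedGraph T rank) {l : List Flip} (hl : D.IsLinearOrdering l)
    (hp : FlipPath T l T') {v : Pt} (hv : v ∈ S) (i : Bool) : newHalf P Q L v i ∈ T' := by
  refine hmarked.mem_of_mem_created hl hp
    ((hD.mem_flips_iff _).2 ⟨v, hv, L, v, .root, rfl⟩) (fun s hs => ?_)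
    (mem_created_parallelogramFlip.2 ⟨i, rfl⟩)
  obtain ⟨w, -, t, L', u, hu, -, j, heq⟩ := (hD.mem_child_iff _ _).1 hs
  obtain ⟨rfl, -⟩ := h.parallelogramFlip_inj heq
  simpa using hu.isSuffix.length_le

end IsLatticeBasis

/-! ### Equilateral lattice triangles -/

/-- The squared Euclidean length of a lattice vector. -/
def sqNorm (z : Pt) : ℤ := z.1 ^ 2 + z.1 * z.2 + z.2 ^ 2

theorem dist_emb_sq (p q : Pt) : dist (emb p) (emb q) ^ 2 = (sqNorm (q - p) : ℝ) := by
  have hsqrt : Real.sqrt 3 * Real.sqrt 3 = 3 := Real.mul_self_sqrt (by norm_num)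
  rw [dist_comm, Complex.dist_eq, ← Complex.normSq_eq_norm_sq, Complex.normSq_apply]
  simp only [emb, sqNorm, Complex.sub_re, Complex.sub_im, Complex.add_re, Complex.add_im,
    Complex.mul_re, Complex.mul_im, Complex.intCast_re, Complex.intCast_im, Prod.fst_sub,
    Prod.snd_sub]
  push_cast
  linear_combination (((q.2 : ℝ) - p.2) ^ 2 / 4) * hsqrt

theorem sqNorm_eq_of_dist_eq {p q p' q' : Pt} (h : dist (emb p) (emb q) = dist (emb p') (emb q')) :
    sqNorm (q - p) = sqNorm (q' - p') := by
  have hcast : (sqNorm (q - p) : ℝ) = sqNorm (q' - p') := by rw [← dist_emb_sq, ← dist_emb_sq, h]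
  exact_mod_cast hcast

theorem sqNorm_rot (z : Pt) : sqNorm (rot z) = sqNorm z := by
  simp only [sqNorm, rot]
  ring

theorem det_rot (z : Pt) : det z (rot z) = sqNorm z := by
  simp only [sqNorm, rot, det]
  ring

theorem sqNorm_pos {z : Pt} (hz : z ≠ 0) : 0 < sqNorm z := by
  obtain ⟨x, y⟩ := z
  have hxy : x ≠ 0 ∨ y ≠ 0 := by
    by_contra! hzero
    exact hz (Prod.ext hzero.1 hzero.2)
  simp only [sqNorm]
  rcases hxy with hx | hy
  · nlinarith [sq_nonneg (x + 2 * y), sq_pos_of_ne_zero hx]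
  · nlinarith [sq_nonneg (2 * x + y), sq_pos_of_ne_zero hy]

theorem eq_of_sqNorm_eq_one {z : Pt} (hz : sqNorm z = 1) :
    z = (1, 0) ∨ z = (0, 1) ∨ z = (-1, 1) ∨ z = (-1, 0) ∨ z = (0, -1) ∨ z = (1, -1) := by
  obtain ⟨x, y⟩ := z
  simp only [sqNorm] at hz
  have hx : x ≤ 1 := by nlinarith [sq_nonneg (x + 2 * y)]
  have hx' : -1 ≤ x := by nlinarith [sq_nonneg (x + 2 * y)]
  have hy : y ≤ 1 := by nlinarith [sq_nonneg (2 * x + y)]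
  have hy' : -1 ≤ y := by nlinarith [sq_nonneg (2 * x + y)]
  interval_cases x <;> interval_cases y <;> simp_all

theorem eq_rot_of_sqNorm_eq {z w : Pt} (hz : z ≠ 0) (hw : sqNorm w = sqNorm z)
    (hsub : sqNorm (w - z) = sqNorm z) : w = rot z ∨ z = rot w := by
  have hpos := sqNorm_pos hz
  obtain ⟨x, y⟩ := z
  obtain ⟨a, b⟩ := w
  obtain ⟨n, hn⟩ : ∃ n, n = x ^ 2 + x * y + y ^ 2 := ⟨_, rfl⟩
  simp only [sqNorm, Prod.mk_sub_mk, rot, Prod.mk.injEq] at hpos hw hsub ⊢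
  rw [← hn] at hpos hw hsub
  have hinner : 2 * x * a + x * b + y * a + 2 * y * b = n := by linarith
  have hdet : (x * b - y * a - n) * (x * b - y * a + n) = 0 := by
    have : 3 * ((x * b - y * a - n) * (x * b - y * a + n)) = 0 := by
      linear_combination (-(2 * x * a + x * b + y * a + 2 * y * b) - n) * hinner +
        4 * (x ^ 2 + x * y + y ^ 2) * hw - 4 * n * hn
    omega
  rcases mul_eq_zero.1 hdet with hdet | hdet
  · have hperp : (x + y) * a + y * b = 0 := by linarith
    exact Or.inl ⟨mul_left_cancel₀ hpos.ne' (by linear_combination x * hperp - y * hdet + a * hn),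
      mul_left_cancel₀ hpos.ne' (by linear_combination (x + y) * hdet + y * hperp + b * hn)⟩
  · have hperp : x * a + x * b + y * b = 0 := by linarith
    exact Or.inr ⟨mul_left_cancel₀ hpos.ne' (by linear_combination a * hperp + b * hdet - x * hw),
      mul_left_cancel₀ hpos.ne' (by linear_combination b * hperp - (a + b) * hdet - y * hw)⟩

theorem exists_eq_rot_of_sqNorm_eq {a b c : Pt} (hab : a ≠ b)
    (hac : sqNorm (c - a) = sqNorm (b - a)) (hbc : sqNorm (c - b) = sqNorm (b - a)) :
    ∃ p z, z ≠ 0 ∧ ({a, b, c} : Finset Pt) = {p, p + z, p + rot z} := by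
  have hz : b - a ≠ 0 := sub_ne_zero.2 hab.symm
  rcases eq_rot_of_sqNorm_eq hz hac (by rwa [sub_sub_sub_cancel_right]) with hrot | hrot
  · exact ⟨a, b - a, hz, by rw [← hrot, add_sub_cancel, add_sub_cancel]⟩
  · refine ⟨a, c - a, fun hzero => hz (by rw [hrot, hzero]; rfl), ?_⟩
    rw [← hrot, add_sub_cancel, add_sub_cancel, Finset.pair_comm]

theorem mem_hull_of_barycentric {a z w : Pt} {p : ℂ} {s t : ℝ} (hs : 0 ≤ s) (ht : 0 ≤ t)
    (hst : s + t ≤ 1) (hp : p = emb a + s * emb z + t * emb w) : p ∈ hull {a, a + z, a + w} := by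
  have hvertex : ∀ q ∈ ({a, a + z, a + w} : Finset Pt), emb q ∈ hull {a, a + z, a + w} :=
    fun q hq => subset_convexHull ℝ _ ⟨q, hq, rfl⟩
  have hconvex : Convex ℝ (hull {a, a + z, a + w}) := convex_convexHull ℝ _
  have hcomb := hconvex.sum_mem
    (t := Finset.univ) (w := ![1 - s - t, s, t]) (z := ![emb a, emb (a + z), emb (a + w)])
    (by intro i _; fin_cases i <;> simp <;> linarith)
    (by simp only [Fin.sum_univ_three, Matrix.cons_val]; ring)
    (by intro i _; fin_cases i <;> exact hvertex _ (by simp))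
  convert hcomb using 1
  simp only [hp, Nat.succ_eq_add_one, Nat.reduceAdd, emb_add, Complex.real_smul,
    Fin.sum_univ_three, Fin.isValue, Matrix.cons_val_zero, Complex.ofReal_sub,
    Complex.ofReal_one, Matrix.cons_val_one, Matrix.cons_val]
  ring

theorem emb_mem_hull_of_det {z w x : Pt} (a : Pt) (hzw : 0 < det z w) (hxw : 0 ≤ det x w)
    (hzx : 0 ≤ det z x) (hle : det x w + det z x ≤ det z w) :
    emb (a + x) ∈ hull {a, a + z, a + w} := by
  have hpos : (0 : ℝ) < det z w := by exact_mod_cast hzw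
  refine mem_hull_of_barycentric (s := det x w / det z w) (t := det z x / det z w)
    (div_nonneg (by exact_mod_cast hxw) hpos.le) (div_nonneg (by exact_mod_cast hzx) hpos.le)
    (by rw [← add_div, div_le_one hpos]; exact_mod_cast hle) ?_
  have hne : (det z w : ℂ) ≠ 0 := by exact_mod_cast hzw.ne'
  rw [emb_add, add_assoc]
  push_cast
  field_simp
  simp only [emb, det]
  push_cast
  ring

theorem exists_unit_mem_triangle (z : Pt) :
    ∃ x : Pt, sqNorm x = 1 ∧ 0 ≤ det x (rot z) ∧ 0 ≤ det z x ∧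
      det x (rot z) + det z x ≤ sqNorm z := by
  obtain ⟨x, y⟩ := z
  have hle : ∀ {a b : ℤ}, 0 ≤ a → 0 ≤ b → b + a ≤ a ^ 2 + a * b + b ^ 2 := fun {a b} ha hb => by
    linarith [mul_nonneg ha hb, Int.le_self_sq a, Int.le_self_sq b]
  have hsextant : (0 ≤ x ∧ 0 ≤ y) ∨ (0 ≤ -x ∧ 0 ≤ x + y) ∨ (0 ≤ y ∧ 0 ≤ -(x + y)) ∨
      (0 ≤ -x ∧ 0 ≤ -y) ∨ (0 ≤ x ∧ 0 ≤ -(x + y)) ∨ (0 ≤ -y ∧ 0 ≤ x + y) := by omega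
  simp only [sqNorm, det, rot]
  rcases hsextant with h | h | h | h | h | h <;> have hsum := hle h.1 h.2
  · exact ⟨(0, 1), by norm_num, by linarith, by linarith, by linarith⟩
  · exact ⟨(-1, 1), by norm_num, by linarith, by linarith, by linarith⟩
  · exact ⟨(-1, 0), by norm_num, by linarith, by linarith, by linarith⟩
  · exact ⟨(0, -1), by norm_num, by linarith, by linarith, by linarith⟩
  · exact ⟨(1, -1), by norm_num, by linarith, by linarith, by linarith⟩
  · exact ⟨(1, 0), by norm_num, by linarith, by linarith, by linarith⟩

theorem sqNorm_eq_one_of_hull {a z : Pt} (hz : z ≠ 0)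
    (hempty : ∀ p, emb p ∈ hull {a, a + z, a + rot z} → p ∈ ({a, a + z, a + rot z} : Finset Pt)) :
    sqNorm z = 1 := by
  obtain ⟨x, hx, hxw, hzx, hle⟩ := exists_unit_mem_triangle z
  rw [← det_rot z] at hle
  have hmem := hempty _ (emb_mem_hull_of_det a (det_rot z ▸ sqNorm_pos hz) hxw hzx hle)
  simp only [Finset.mem_insert, Finset.mem_singleton, add_eq_left, add_right_inj] at hmem
  rcases hmem with rfl | rfl | rfl
  · simp [sqNorm] at hx
  · exact hx
  · rwa [sqNorm_rot] at hx

/-! ### The triangles of an equilateral triangulation -/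

theorem IsTriangulation.mem_of_emb_mem_hull {Ω : Set ℂ} {T : Set (Finset Pt)}
    (hT : IsTriangulation Ω T) {t : Finset Pt} (ht : t ∈ T) {p : Pt} (hp : emb p ∈ hull t) :
    p ∈ t := by
  obtain ⟨t', ht', hpt'⟩ := hT.uses_all p (hT.cover ▸ Set.mem_biUnion ht hp)
  have hspan : emb p ∈ affineSpan ℝ (emb '' ((t ∩ t' : Finset Pt) : Set Pt)) := by
    refine convexHull_subset_affineSpan (𝕜 := ℝ) _ (?_ : emb p ∈ hull (t ∩ t'))
    rw [← hT.face_to_face t ht t' ht']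
    exact ⟨hp, subset_convexHull ℝ _ ⟨p, hpt', rfl⟩⟩
  have himage : emb '' ((t ∩ t' : Finset Pt) : Set Pt) =
      (fun q : t' => emb q) '' {q : t' | (q : Pt) ∈ t} := by
    ext z
    constructor
    · rintro ⟨q, hq, rfl⟩
      rw [Finset.mem_coe, Finset.mem_inter] at hq
      exact ⟨⟨q, hq.2⟩, hq.1, rfl⟩
    · rintro ⟨⟨q, hq⟩, hq', rfl⟩
      exact ⟨q, Finset.mem_coe.2 (Finset.mem_inter.2 ⟨hq', hq⟩), rfl⟩
  rw [himage] at hspan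
  exact ((hT.nondegenerate t' ht').mem_affineSpan_iff ⟨p, hpt'⟩ _).1 hspan

theorem IsEquilateralTriangulation.sqNorm_sub_eq {Ω : Set ℂ} {T : Set (Finset Pt)}
    (hT : IsEquilateralTriangulation Ω T) {t : Finset Pt} (ht : t ∈ T) {p q p' q' : Pt}
    (hp : p ∈ t) (hq : q ∈ t) (hp' : p' ∈ t) (hq' : q' ∈ t) (hpq : p ≠ q) (hpq' : p' ≠ q') :
    sqNorm (q - p) = sqNorm (q' - p') :=
  sqNorm_eq_of_dist_eq (hT.equal_length p q p' q' ⟨p, q, hpq, rfl, t, ht, hp, hq⟩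
    ⟨p', q', hpq', rfl, t, ht, hp', hq'⟩)

theorem IsEquilateralTriangulation.exists_unit {Ω : Set ℂ} {T : Set (Finset Pt)}
    (hT : IsEquilateralTriangulation Ω T) {t : Finset Pt} (ht : t ∈ T) :
    ∃ a z, sqNorm z = 1 ∧ t = {a, a + z, a + rot z} := by
  obtain ⟨a, b, c, hab, hac, hbc, habc⟩ := Finset.card_eq_three.1 (hT.card_eq t ht)
  have ha : a ∈ t := by simp [habc]
  have hb : b ∈ t := by simp [habc]
  have hc : c ∈ t := by simp [habc]
  obtain ⟨p, z, hz, hpz⟩ := exists_eq_rot_of_sqNorm_eq hab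
    (hT.sqNorm_sub_eq ht ha hc ha hb hac hab) (hT.sqNorm_sub_eq ht hb hc ha hb hbc hab)
  rw [habc, hpz] at ht
  exact ⟨p, z, sqNorm_eq_one_of_hull hz fun x hx => hT.mem_of_emb_mem_hull ht hx, habc.trans hpz⟩

/-- `P` and `Q` are unit vectors at an angle of 60 degrees. -/
def IsUnitFrame (P Q : Pt) : Prop :=
  (sqNorm P = 1 ∧ Q = rot P) ∨ (sqNorm Q = 1 ∧ P = rot Q)

theorem IsUnitFrame.isLatticeBasis {P Q : Pt} (h : IsUnitFrame P Q) : IsLatticeBasis P Q := by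
  rcases h with ⟨h, rfl⟩ | ⟨h, rfl⟩
  · rw [IsLatticeBasis, det_rot, h, one_mul]
  · rw [IsLatticeBasis, det_swap, det_rot, h]
    norm_num

theorem IsUnitFrame.swap {P Q : Pt} (h : IsUnitFrame P Q) : IsUnitFrame Q P := Or.symm h

theorem oldHalf_nil_swap (P Q u : Pt) (i : Bool) : oldHalf Q P [] u i = oldHalf P Q [] u i := by
  cases i <;> simp only [oldHalf, side, diagonal, add_comm Q P, if_true, Bool.false_eq_true,
    if_false, Finset.pair_comm (u + Q)]

theorem exists_eq_oldHalf_of_sqNorm_eq_one {P Q z : Pt} (h : IsUnitFrame P Q) (a : Pt)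
    (hz : sqNorm z = 1) : ∃ u i, ({a, a + z, a + rot z} : Finset Pt) = oldHalf P Q [] u i := by
  wlog hPQ : sqNorm P = 1 ∧ Q = rot P generalizing P Q
  · obtain ⟨u, i, heq⟩ := this h.swap (h.resolve_left hPQ)
    exact ⟨u, i, heq.trans (oldHalf_nil_swap _ _ _ _)⟩
  obtain ⟨hP, rfl⟩ := hPQ
  have hrot : z = P ∨ z = rot P ∨ z = rot P - P ∨ z = -P ∨ z = -rot P ∨ z = P - rot P := by
    rcases eq_of_sqNorm_eq_one hP with rfl | rfl | rfl | rfl | rfl | rfl <;>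
    rcases eq_of_sqNorm_eq_one hz with rfl | rfl | rfl | rfl | rfl | rfl <;> decide
  obtain ⟨p, q⟩ := P
  obtain ⟨x, y⟩ := a
  clear h hP hz
  rcases hrot with rfl | rfl | rfl | rfl | rfl | rfl
  · exact ⟨(x, y), true, rfl⟩
  · exact ⟨(x, y) - (p, q), false, by ext ⟨x', y'⟩; simp [oldHalf, side, diagonal, rot]; omega⟩
  · exact ⟨(x, y) - (p, q), true, by ext ⟨x', y'⟩; simp [oldHalf, side, rot]; omega⟩
  · exact ⟨(x, y) - (p, q) - rot (p, q), false, by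
      ext ⟨x', y'⟩; simp [oldHalf, side, diagonal, rot]; omega⟩
  · exact ⟨(x, y) - rot (p, q), true, by ext ⟨x', y'⟩; simp [oldHalf, side, rot]; omega⟩
  · exact ⟨(x, y) - rot (p, q), false, by
      ext ⟨x', y'⟩; simp [oldHalf, side, diagonal, rot]; omega⟩

section

variable {Ω : Set ℂ} {T : Set (Finset Pt)} {P Q : Pt}

theorem IsEquilateralTriangulation.exists_eq_oldHalf (hT : IsEquilateralTriangulation Ω T)
    (h : IsUnitFrame P Q) {t : Finset Pt} (ht : t ∈ T) : ∃ u i, t = oldHalf P Q [] u i := by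
  obtain ⟨a, z, hz, rfl⟩ := hT.exists_unit ht
  exact exists_eq_oldHalf_of_sqNorm_eq_one h a hz

theorem IsEquilateralTriangulation.height_le (hT : IsEquilateralTriangulation Ω T)
    (h : IsUnitFrame P Q) {t : Finset Pt} (ht : t ∈ T) {a b : Pt} (ha : a ∈ t) (hb : b ∈ t) :
    height P Q a ≤ height P Q b + 1 := by
  obtain ⟨u, i, rfl⟩ := hT.exists_eq_oldHalf h ht
  have hP := h.isLatticeBasis.height_left
  have hQ := h.isLatticeBasis.height_right
  cases i <;> simp only [oldHalf, side, diagonal, if_true, Bool.false_eq_true, if_false,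
      Finset.mem_insert, Finset.mem_singleton] at ha hb <;>
    rcases ha with rfl | rfl | rfl <;> rcases hb with rfl | rfl | rfl <;>
    (try simp only [map_add]) <;> omega

end

/-! ### Crossings -/

/-- The real-linear extension to the plane of an additive function on the lattice. -/
noncomputable def extend (f : Pt →+ ℤ) : ℂ →ₗ[ℝ] ℝ :=
  (f (1, 0) : ℝ) • (Complex.reLm - (1 / Real.sqrt 3) • Complex.imLm) +
    (f (0, 1) : ℝ) • (2 / Real.sqrt 3) • Complex.imLm

theorem extend_emb (f : Pt →+ ℤ) (p : Pt) : extend f (emb p) = f p := by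
  have hsqrt : Real.sqrt 3 ≠ 0 := by positivity
  have hp : f p = p.1 * f (1, 0) + p.2 * f (0, 1) := by
    rw [← smul_eq_mul, ← smul_eq_mul, ← map_zsmul, ← map_zsmul, ← map_add]
    congr 1
    ext <;> simp
  rw [hp]
  simp only [extend, one_div, emb, LinearMap.add_apply, LinearMap.smul_apply,
    LinearMap.sub_apply, Complex.reLm_coe, Complex.add_re, Complex.intCast_re, Complex.mul_re,
    Complex.intCast_im, zero_mul, sub_zero, Complex.imLm_coe, Complex.add_im, Complex.mul_im,
    add_zero, zero_add, smul_eq_mul, Int.cast_add, Int.cast_mul]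
  field_simp
  ring

theorem extend_lineMap (f : Pt →+ ℤ) (v w : Pt) (s : ℝ) :
    extend f (AffineMap.lineMap (emb v) (emb (v + w)) s) = f v + s * f w := by
  rw [AffineMap.lineMap_apply_module, map_add, map_smul, map_smul, extend_emb, extend_emb, map_add,
    smul_eq_mul, smul_eq_mul]
  push_cast
  ring

theorem le_of_mem_hull (f : ℂ →ₗ[ℝ] ℝ) {c : ℝ} {t : Finset Pt} (h : ∀ p ∈ t, f (emb p) ≤ c)
    {z : ℂ} (hz : z ∈ hull t) : f z ≤ c := by
  have hsubset : hull t ⊆ {z | f z ≤ c} := by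
    refine convexHull_min ?_ (convex_halfSpace_le f.isLinear c)
    rintro _ ⟨p, hp, rfl⟩
    exact h p hp
  exact hsubset hz

theorem ge_of_mem_hull (f : ℂ →ₗ[ℝ] ℝ) {c : ℝ} {t : Finset Pt} (h : ∀ p ∈ t, c ≤ f (emb p))
    {z : ℂ} (hz : z ∈ hull t) : c ≤ f z := by
  simpa using le_of_mem_hull (-f) (c := -c) (fun p hp => by simpa using h p hp) hz

/-- The segment from `v` to `v + w` crosses the segment from `u + A` to `u + B` in relatively
interior points of both. The coordinates with respect to `A` and `B` are `m, n` for `w` and `i, j`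
for `u - v`; the segment meets the line `x + y = i + j + 1` at `x = m (i + j + 1) / (m + n)`, and
the last two inequalities say that `i < x < i + 1`. -/
def Crosses {M : Type*} [AddCommGroup M] (A B w v u : M) : Prop :=
  ∃ m n i j : ℤ, w = m • A + n • B ∧ u = v + (i • A + j • B) ∧ 0 ≤ i ∧ i < m ∧ 0 ≤ j ∧ j < n ∧
    m * j < n * (i + 1) ∧ n * i < m * (j + 1)

section Crosses

variable {M : Type*} [AddCommGroup M] {A B w v u : M}

theorem crosses_add (A B v : M) : Crosses A B (A + B) v v :=
  ⟨1, 1, 0, 0, by module, by module, by norm_num⟩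

theorem Crosses.swap (h : Crosses A B w v u) : Crosses B A w v u := by
  obtain ⟨m, n, i, j, hw, hu, hi, him, hj, hjn, hlt, hlt'⟩ := h
  exact ⟨n, m, j, i, by rw [hw, add_comm], by rw [hu, add_comm (i • A)], hj, hjn, hi, him,
    hlt', hlt⟩

theorem Crosses.of_add_right (h : Crosses A (A + B) w v u) (k : Bool) :
    Crosses A B w v (if k then u else u + A) := by
  obtain ⟨m, n, i, j, rfl, rfl, hi, him, hj, hjn, hlt, hlt'⟩ := h
  cases k
  · exact ⟨m + n, n, i + j + 1, j, by module, by simp only [Bool.false_eq_true, if_false]; module,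
      by omega, by omega, by omega, by omega, by linarith, by linarith⟩
  · exact ⟨m + n, n, i + j, j, by module, by simp only [if_true]; module,
      by omega, by omega, by omega, by omega, by linarith, by linarith⟩

end Crosses

open Filter Topology in
theorem exists_parameter {m n i j : ℤ} (hi : 0 ≤ i) (him : i < m) (hj : 0 ≤ j) (hjn : j < n)
    (hlt : m * j < n * (i + 1)) (hlt' : n * i < m * (j + 1)) (b : Bool) :
    ∃ s ∈ Set.Icc (0 : ℝ) 1, s * m ∈ Set.Ioo (i : ℝ) (i + 1) ∧ s * n ∈ Set.Ioo (j : ℝ) (j + 1) ∧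
      if b then s * (m + n) < i + j + 1 else i + j + 1 < s * (m + n) := by
  have hmn : (0 : ℝ) < m + n := by exact_mod_cast (by omega : 0 < m + n)
  obtain ⟨s₀, hs₀⟩ : ∃ s₀ : ℝ, s₀ * (m + n) = i + j + 1 := ⟨_, div_mul_cancel₀ _ hmn.ne'⟩
  have hpos : 0 < s₀ ∧ s₀ < 1 := by
    constructor <;> refine (mul_lt_mul_iff_of_pos_right hmn).1 ?_ <;> rw [hs₀] <;> norm_cast <;> lia
  have hm : s₀ * m ∈ Set.Ioo (i : ℝ) (i + 1) := by
    constructor <;> refine (mul_lt_mul_iff_of_pos_right hmn).1 ?_ <;> rw [mul_right_comm, hs₀] <;>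
      norm_cast <;> linarith
  have hn : s₀ * n ∈ Set.Ioo (j : ℝ) (j + 1) := by
    constructor <;> refine (mul_lt_mul_iff_of_pos_right hmn).1 ?_ <;> rw [mul_right_comm, hs₀] <;>
      norm_cast <;> linarith
  have hnear : ∀ᶠ s in 𝓝 s₀, s ∈ Set.Icc (0 : ℝ) 1 ∧ s * m ∈ Set.Ioo (i : ℝ) (i + 1) ∧
      s * n ∈ Set.Ioo (j : ℝ) (j + 1) :=
    .and (Icc_mem_nhds hpos.1 hpos.2)
      (.and ((continuous_mul_const _).continuousAt.eventually_mem (Ioo_mem_nhds hm.1 hm.2))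
        ((continuous_mul_const _).continuousAt.eventually_mem (Ioo_mem_nhds hn.1 hn.2)))
  cases b
  · obtain ⟨s, ⟨hs, hsm, hsn⟩, hgt⟩ :=
      ((hnear.filter_mono nhdsWithin_le_nhds).and (self_mem_nhdsWithin (s := Set.Ioi s₀))).exists
    exact ⟨s, hs, hsm, hsn, by simpa [← hs₀] using mul_lt_mul_of_pos_right hgt hmn⟩
  · obtain ⟨s, ⟨hs, hsm, hsn⟩, hlt⟩ :=
      ((hnear.filter_mono nhdsWithin_le_nhds).and (self_mem_nhdsWithin (s := Set.Iio s₀))).exists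
    exact ⟨s, hs, hsm, hsn, by simpa [← hs₀] using mul_lt_mul_of_pos_right hlt hmn⟩

theorem IsDescendant.crosses {P Q : Pt} {L L' : List Bool} {v u : Pt}
    (h : IsDescendant P Q L v L' u) (i : Bool) :
    Crosses (side P Q L' i) (side P Q L' !i) (diagonal P Q L) v u := by
  induction h generalizing i with
  | root => exact diagonal_eq_add_side P Q L i ▸ crosses_add _ _ _
  | @child t L' u _ k ih =>
    have hchild : Crosses (side P Q L' t) (side P Q L' !t) (diagonal P Q L) v
        (childPoint P Q t L' u k) := by
      have hparent := ih t
      rw [side_cons_self, side_cons_not, diagonal_eq_add_side P Q L' t] at hparent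
      exact hparent.of_add_right k
    rcases Bool.eq_or_eq_not i t with rfl | rfl
    · exact hchild
    · rw [Bool.not_not]
      exact hchild.swap

namespace IsLatticeBasis

variable {P Q : Pt} (h : IsLatticeBasis P Q)

include h

theorem eq_of_coord_eq {a b : Pt} (hfst : fstCoord P Q a = fstCoord P Q b)
    (hsnd : sndCoord P Q a = sndCoord P Q b) : a = b := by
  have hdet : det P Q ≠ 0 := left_ne_zero_of_mul_eq_one h
  have hQ := mul_left_cancel₀ hdet hfst
  have hP := mul_left_cancel₀ hdet hsnd
  simp only [det] at hQ hP hdet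
  refine Prod.ext (mul_left_cancel₀ hdet ?_) (mul_left_cancel₀ hdet ?_)
  · linear_combination P.1 * hQ + Q.1 * hP
  · linear_combination P.2 * hQ + Q.2 * hP

theorem coord_bounds_of_mem_hull {u : Pt} {i : Bool} {z : ℂ} (hz : z ∈ hull (oldHalf P Q [] u i)) :
    extend (fstCoord P Q) z ∈ Set.Icc (fstCoord P Q u : ℝ) (fstCoord P Q u + 1) ∧
    extend (sndCoord P Q) z ∈ Set.Icc (sndCoord P Q u : ℝ) (sndCoord P Q u + 1) ∧
    if i then extend (height P Q) z ≤ height P Q u + 1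
      else height P Q u + 1 ≤ extend (height P Q) z := by
  have hvertex : ∀ p ∈ oldHalf P Q [] u i,
      (fstCoord P Q u ≤ fstCoord P Q p ∧ fstCoord P Q p ≤ fstCoord P Q u + 1) ∧
      (sndCoord P Q u ≤ sndCoord P Q p ∧ sndCoord P Q p ≤ sndCoord P Q u + 1) ∧
      if i then height P Q p ≤ height P Q u + 1 else height P Q u + 1 ≤ height P Q p := by
    intro p hp
    simp only [oldHalf, side, diagonal, Finset.mem_insert, Finset.mem_singleton] at hp
    rcases hp with rfl | rfl | rfl <;> cases i <;>
      simp [h.fstCoord_left, h.sndCoord_right, fstCoord_right, sndCoord_left, h.height_left,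
        h.height_right]
  refine ⟨⟨ge_of_mem_hull _ (fun p hp => ?_) hz, le_of_mem_hull _ (fun p hp => ?_) hz⟩,
    ⟨ge_of_mem_hull _ (fun p hp => ?_) hz, le_of_mem_hull _ (fun p hp => ?_) hz⟩, ?_⟩
  · exact_mod_cast extend_emb _ p ▸ Int.cast_le.2 (hvertex p hp).1.1
  · exact_mod_cast extend_emb _ p ▸ Int.cast_le.2 (hvertex p hp).1.2
  · exact_mod_cast extend_emb _ p ▸ Int.cast_le.2 (hvertex p hp).2.1.1
  · exact_mod_cast extend_emb _ p ▸ Int.cast_le.2 (hvertex p hp).2.1.2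
  · cases i
    · exact ge_of_mem_hull _ (fun p hp => by
        rw [extend_emb]; exact_mod_cast (hvertex p hp).2.2) hz
    · exact le_of_mem_hull _ (fun p hp => by
        rw [extend_emb]; exact_mod_cast (hvertex p hp).2.2) hz

theorem eq_of_mem_hull {u u' : Pt} {i : Bool} {z : ℂ} (hz : z ∈ hull (oldHalf P Q [] u' i))
    (hfst : extend (fstCoord P Q) z ∈ Set.Ioo (fstCoord P Q u : ℝ) (fstCoord P Q u + 1))
    (hsnd : extend (sndCoord P Q) z ∈ Set.Ioo (sndCoord P Q u : ℝ) (sndCoord P Q u + 1)) :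
    u' = u := by
  have heq : ∀ {x : ℝ} {a b : ℤ}, x ∈ Set.Icc (b : ℝ) (b + 1) → x ∈ Set.Ioo (a : ℝ) (a + 1) →
      b = a := fun {x a b} hb ha => by
    have hlt : (b : ℝ) < a + 1 := hb.1.trans_lt ha.2
    have hlt' : (a : ℝ) < b + 1 := ha.1.trans_le hb.2
    norm_cast at hlt hlt'
    omega
  obtain ⟨hfst', hsnd', -⟩ := h.coord_bounds_of_mem_hull hz
  exact h.eq_of_coord_eq (heq hfst' hfst) (heq hsnd' hsnd)

end IsLatticeBasis

namespace IsEquilateralTriangulation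

variable {Ω : Set ℂ} {T : Set (Finset Pt)} (hT : IsEquilateralTriangulation Ω T)
  {P Q : Pt} (h : IsUnitFrame P Q)

include hT h

theorem exists_oldHalf_mem_hull {z : ℂ} (hz : z ∈ Ω) :
    ∃ u i, oldHalf P Q [] u i ∈ T ∧ z ∈ hull (oldHalf P Q [] u i) := by
  rw [← hT.cover, Set.mem_iUnion₂] at hz
  obtain ⟨t, ht, hz⟩ := hz
  obtain ⟨u, i, rfl⟩ := hT.exists_eq_oldHalf h ht
  exact ⟨u, i, ht, hz⟩

theorem oldHalf_mem_of_coord {u : Pt} {z : ℂ} (hz : z ∈ Ω)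
    (hfst : extend (fstCoord P Q) z ∈ Set.Ioo (fstCoord P Q u : ℝ) (fstCoord P Q u + 1))
    (hsnd : extend (sndCoord P Q) z ∈ Set.Ioo (sndCoord P Q u : ℝ) (sndCoord P Q u + 1)) {i : Bool}
    (hheight : if i then extend (height P Q) z < height P Q u + 1
      else height P Q u + 1 < extend (height P Q) z) : oldHalf P Q [] u i ∈ T := by
  obtain ⟨u', i', hmem, hz⟩ := hT.exists_oldHalf_mem_hull h hz
  obtain rfl := h.isLatticeBasis.eq_of_mem_hull hz hfst hsnd
  obtain ⟨-, -, hheight'⟩ := h.isLatticeBasis.coord_bounds_of_mem_hull hz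
  cases i <;> cases i'
  · exact hmem
  · exact absurd hheight' (not_le.2 hheight)
  · exact absurd hheight' (not_le.2 hheight)
  · exact hmem

theorem mem_edges_of_unit {v : Pt} (hseg : segment ℝ (emb v) (emb (v + P)) ⊆ Ω) :
    s(v, v + P) ∈ edges T := by
  have hbasis := h.isLatticeBasis
  have hne : v ≠ v + P := fun heq => by
    obtain rfl : P = 0 := left_eq_add.1 heq
    exact zero_ne_one ((map_zero _).symm.trans hbasis.fstCoord_left)
  obtain ⟨u, i, ht, hz⟩ := hT.exists_oldHalf_mem_hull h (hseg (midpoint_mem_segment _ _))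
  obtain ⟨hfst, hsnd, hheight⟩ := hbasis.coord_bounds_of_mem_hull hz
  simp only [midpoint, extend_lineMap, hbasis.fstCoord_left, sndCoord_left, hbasis.height_left,
    height_apply, invOf_eq_inv, Int.cast_one, Int.cast_zero, Int.cast_add, mul_one, mul_zero,
    add_zero, Set.mem_Icc] at hfst hsnd hheight
  have hfst_lt : (fstCoord P Q u : ℝ) < fstCoord P Q v + 1 := by linarith
  have hlt_fst : (fstCoord P Q v : ℝ) < fstCoord P Q u + 1 := by linarith
  norm_cast at hfst_lt hlt_fst hsnd
  have hfst_eq : fstCoord P Q u = fstCoord P Q v := by omega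
  rw [hfst_eq] at hheight
  refine ⟨v, v + P, hne, rfl, _, ht, ?_⟩
  cases i
  · have hlt : (sndCoord P Q u : ℝ) < sndCoord P Q v := by
      simp only [Bool.false_eq_true, if_false] at hheight
      linarith
    norm_cast at hlt
    obtain rfl : v = u + Q := hbasis.eq_of_coord_eq
      (by rw [map_add, fstCoord_right, add_zero, hfst_eq])
      (by rw [map_add, hbasis.sndCoord_right]; omega)
    simp [oldHalf, side, diagonal, add_assoc, add_comm P Q]
  · have hlt : (sndCoord P Q v : ℝ) < sndCoord P Q u + 1 := by
      simp only [if_true] at hheight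
      linarith
    norm_cast at hlt
    obtain rfl : v = u := hbasis.eq_of_coord_eq hfst_eq.symm (by omega)
    simp [oldHalf, side]

theorem oldHalf_mem_of_crosses {v w u : Pt}
    (hseg : segment ℝ (emb v) (emb (v + w)) ⊆ Ω) (hcross : Crosses P Q w v u) (b : Bool) :
    oldHalf P Q [] u b ∈ T := by
  obtain ⟨m, n, i, j, rfl, rfl, hi, him, hj, hjn, hlt, hlt'⟩ := hcross
  have hbasis := h.isLatticeBasis
  obtain ⟨s, hs, hfst, hsnd, hheight⟩ := exists_parameter hi him hj hjn hlt hlt' b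
  refine hT.oldHalf_mem_of_coord h (hseg (lineMap_mem_segment ℝ _ _ hs)) ?_ ?_ ?_
  · simpa [-zsmul_eq_mul, extend_lineMap, hbasis.fstCoord_left, fstCoord_right, add_assoc]
      using hfst
  · simpa [-zsmul_eq_mul, extend_lineMap, hbasis.sndCoord_right, sndCoord_left, add_assoc]
      using hsnd
  · cases b <;> simpa [-zsmul_eq_mul, extend_lineMap, hbasis.height_left, hbasis.height_right,
      add_assoc] using hheight

theorem oldHalf_mem_of_isDescendant {L : List Bool} {v u : Pt}
    (hseg : segment ℝ (emb v) (emb (v + diagonal P Q L)) ⊆ Ω) (hu : IsDescendant P Q L v [] u)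
    (i : Bool) : oldHalf P Q [] u i ∈ T :=
  hT.oldHalf_mem_of_crosses h hseg (hu.crosses true) i

end IsEquilateralTriangulation

/-! ### The Stern–Brocot tree -/

/-- The fraction with given numerator and denominator. -/
def frac (p : ℕ × ℕ) : ℚ := (p.1 : ℚ) / p.2

theorem frac_lt_frac {p r : ℕ × ℕ} (hp : 0 < p.2) (hr : 0 < r.2) :
    frac p < frac r ↔ p.1 * r.2 < r.1 * p.2 := by
  rw [frac, frac, div_lt_div_iff₀ (by exact_mod_cast hp) (by exact_mod_cast hr)]
  exact_mod_cast Iff.rfl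

theorem num_frac {p : ℕ × ℕ} (hp : 0 < p.2) (h : p.1.Coprime p.2) : (frac p).num = p.1 := by
  simpa [frac] using
    Rat.num_div_eq_of_coprime (a := p.1) (b := p.2) (by exact_mod_cast hp) (by simpa using h)

theorem den_frac {p : ℕ × ℕ} (hp : 0 < p.2) (h : p.1.Coprime p.2) : (frac p).den = p.2 := by
  have hden :=
    Rat.den_div_eq_of_coprime (a := p.1) (b := p.2) (by exact_mod_cast hp) (by simpa using h)
  rw [Int.cast_natCast, Int.cast_natCast] at hden
  exact Int.natCast_inj.1 hden

theorem frac_natAbs_num_den {f : ℚ} (hf : 0 ≤ f) : frac (f.num.natAbs, f.den) = f := by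
  rw [frac, Nat.cast_natAbs, abs_of_nonneg (Rat.num_nonneg.2 hf), Rat.num_div_den]

theorem eq_of_frac_eq {p r : ℕ × ℕ} (hp : 0 < p.2) (hp' : p.1.Coprime p.2) (hr : 0 < r.2)
    (hr' : r.1.Coprime r.2) (h : frac p = frac r) : p = r := by
  refine Prod.ext ?_ ?_
  · exact_mod_cast (num_frac hp hp').symm.trans (h ▸ num_frac hr hr')
  · exact (den_frac hp hp').symm.trans (h ▸ den_frac hr hr')

theorem mediant_frac {p r : ℕ × ℕ} (hp : 0 < p.2) (hp' : p.1.Coprime p.2) (hr : 0 < r.2)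
    (hr' : r.1.Coprime r.2) : mediant (frac p) (frac r) = frac (p + r) := by
  rw [mediant, num_frac hp hp', num_frac hr hr', den_frac hp hp', den_frac hr hr', frac]
  push_cast [Prod.fst_add, Prod.snd_add]
  rfl

/-- The lower parent of the node reached by a list of steps in the Stern–Brocot tree, last step
first; `true` is a step to the left. A pair stands for numerator and denominator. -/
def lowerParent (L : List Bool) : ℕ × ℕ := side (0, 1) (1, 0) L true

/-- The upper parent of a node of the Stern–Brocot tree. That of the root is `(1, 0)`, which `frac`
maps to `0`. -/
def upperParent (L : List Bool) : ℕ × ℕ := side (0, 1) (1, 0) L false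

/-- A node of the Stern–Brocot tree, the mediant of its parents. -/
def node (L : List Bool) : ℕ × ℕ := diagonal (0, 1) (1, 0) L

theorem node_eq_add (L : List Bool) : node L = lowerParent L + upperParent L := rfl

theorem lowerParent_true (L : List Bool) : lowerParent (true :: L) = lowerParent L := rfl

theorem upperParent_true (L : List Bool) : upperParent (true :: L) = node L := rfl

theorem lowerParent_false (L : List Bool) : lowerParent (false :: L) = node L := add_comm _ _

theorem upperParent_false (L : List Bool) : upperParent (false :: L) = upperParent L := rfl

theorem node_true (L : List Bool) : node (true :: L) = node L + lowerParent L := add_comm _ _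

theorem node_false (L : List Bool) : node (false :: L) = node L + upperParent L := by
  rw [node_eq_add, lowerParent_false, upperParent_false]

theorem upperParent_mul_lowerParent (L : List Bool) :
    (upperParent L).1 * (lowerParent L).2 = (lowerParent L).1 * (upperParent L).2 + 1 := by
  induction L with
  | nil => rfl
  | cons t L ih =>
    cases t <;>
      simp only [lowerParent_true, upperParent_true, lowerParent_false, upperParent_false,
        node_eq_add, Prod.fst_add, Prod.snd_add] <;>
      linarith

theorem lowerParent_pos (L : List Bool) : 0 < (lowerParent L).2 :=
  Nat.pos_of_ne_zero fun hzero => by simpa [hzero] using upperParent_mul_lowerParent L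

theorem node_pos (L : List Bool) : 0 < (node L).2 := Nat.add_pos_left (lowerParent_pos L) _

theorem coprime_of_mul_eq_mul_add_one {a b c d : ℕ} (h : c * b = a * d + 1) :
    a.Coprime b ∧ c.Coprime d := by
  have hdet : (c * b : ℤ) = a * d + 1 := by exact_mod_cast h
  exact ⟨Nat.isCoprime_iff_coprime.1 ⟨-d, c, by linear_combination hdet⟩,
    Nat.isCoprime_iff_coprime.1 ⟨b, -a, by linear_combination hdet⟩⟩

theorem coprime_lowerParent (L : List Bool) : (lowerParent L).1.Coprime (lowerParent L).2 :=
  (coprime_of_mul_eq_mul_add_one (upperParent_mul_lowerParent L)).1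

theorem coprime_upperParent (L : List Bool) : (upperParent L).1.Coprime (upperParent L).2 :=
  (coprime_of_mul_eq_mul_add_one (upperParent_mul_lowerParent L)).2

theorem coprime_node (L : List Bool) : (node L).1.Coprime (node L).2 :=
  coprime_upperParent (true :: L)

theorem frac_lowerParent_lt_frac_node (L : List Bool) : frac (lowerParent L) < frac (node L) := by
  rw [frac_lt_frac (lowerParent_pos L) (node_pos L), node_eq_add, Prod.fst_add, Prod.snd_add]
  linarith [upperParent_mul_lowerParent L]

theorem frac_node_lt_frac_upperParent {L : List Bool} (h : 0 < (upperParent L).2) :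
    frac (node L) < frac (upperParent L) := by
  rw [frac_lt_frac (node_pos L) h, node_eq_add, Prod.fst_add, Prod.snd_add]
  linarith [upperParent_mul_lowerParent L]

theorem node_snd_le_of_between {L : List Bool} {m n : ℕ}
    (hlower : (lowerParent L).1 * n < m * (lowerParent L).2)
    (hupper : m * (upperParent L).2 < (upperParent L).1 * n) : (node L).2 ≤ n := by
  have hdet := upperParent_mul_lowerParent L
  rw [node_eq_add, Prod.snd_add]
  zify at *
  -- By unimodularity `(m, n)` is an integral combination of the parents, with coefficients `≥ 1`.
  have hcombination : (n : ℤ) =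
      ((upperParent L).1 * n - m * (upperParent L).2) * (lowerParent L).2 +
        (m * (lowerParent L).2 - (lowerParent L).1 * n) * (upperParent L).2 := by
    linear_combination (-(n : ℤ)) * hdet
  rw [hcombination]
  gcongr
  · exact le_mul_of_one_le_left (Int.natCast_nonneg _) (by linarith)
  · exact le_mul_of_one_le_left (Int.natCast_nonneg _) (by linarith)

/-- A list of steps in the Stern–Brocot tree, last step first, that stays in `[0, 1]`: the first
step goes to the left. -/
inductive IsFareyPath : List Bool → Prop
  | nil : IsFareyPath []
  | singleton : IsFareyPath [true]
  | cons {L : List Bool} (t : Bool) (hne : L ≠ []) (h : IsFareyPath L) : IsFareyPath (t :: L)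

namespace IsFareyPath

variable {L : List Bool}

theorem cons_true (h : IsFareyPath L) : IsFareyPath (true :: L) := by
  rcases eq_or_ne L [] with rfl | hne
  · exact singleton
  · exact h.cons true hne

theorem of_cons {t : Bool} (h : IsFareyPath (t :: L)) : IsFareyPath L := by
  cases h with
  | singleton => exact nil
  | cons _ _ h => exact h

theorem parents_bounds (h : IsFareyPath L) (hne : L ≠ []) : 0 < (upperParent L).2 ∧
    (upperParent L).1 ≤ (upperParent L).2 ∧ (lowerParent L).1 < (lowerParent L).2 := by
  induction h with
  | nil => exact absurd rfl hne
  | singleton => decide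
  | cons t hne' _ ih =>
    have hbounds := ih hne'
    cases t <;>
      simp only [lowerParent_true, upperParent_true, lowerParent_false, upperParent_false,
        node_eq_add, Prod.fst_add, Prod.snd_add] <;>
      omega

theorem node_fst_lt_snd (h : IsFareyPath L) (hne : L ≠ []) : (node L).1 < (node L).2 := by
  obtain ⟨-, hupper, hlower⟩ := h.parents_bounds hne
  rw [node_eq_add, Prod.fst_add, Prod.snd_add]
  omega

end IsFareyPath

/-! ### Farey sequences -/

theorem getLastD_eq_of_pairwise_le {α : Type*} [PartialOrder α] {Y : List α}
    (hY : Y.Pairwise (· ≤ ·)) {p : α} (hp : p ∈ Y) (hmax : ∀ y ∈ Y, y ≤ p) (d : α) :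
    Y.getLastD d = p := by
  rcases List.eq_nil_or_concat' Y with rfl | ⟨Y', z, rfl⟩
  · simp at hp
  · have hle : p ≤ z := by
      rcases List.mem_append.1 hp with hp | hp
      · exact (List.pairwise_append.1 hY).2.2 p hp z (by simp)
      · exact (List.mem_singleton.1 hp).le
    rw [List.getLastD_eq_getLast?]
    simpa using le_antisymm (hmax z (by simp)) hle

theorem headD_eq_of_pairwise_le {α : Type*} [PartialOrder α] {Y : List α}
    (hY : Y.Pairwise (· ≤ ·)) {p : α} (hp : p ∈ Y) (hmin : ∀ y ∈ Y, p ≤ y) (d : α) :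
    Y.headD d = p := by
  cases Y with
  | nil => simp at hp
  | cons z Y =>
    refine le_antisymm ?_ (hmin z (by simp))
    rcases List.mem_cons.1 hp with rfl | hp
    · exact le_rfl
    · exact List.rel_of_pairwise_cons hY hp

theorem before_eq {X : List ℚ} (hX : X.Pairwise (· ≤ ·)) {p d : ℚ} (hp : p ∈ X) (hpd : p < d)
    (hmax : ∀ x ∈ X, x < d → x ≤ p) : before X d = p :=
  getLastD_eq_of_pairwise_le (hX.filter _) (by simp [hp, hpd]) (by simpa using hmax) _

theorem after_eq {X : List ℚ} (hX : X.Pairwise (· ≤ ·)) {p d : ℚ} (hp : p ∈ X) (hpd : d < p)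
    (hmin : ∀ x ∈ X, d < x → p ≤ x) : after X d = p :=
  headD_eq_of_pairwise_le (hX.filter _) (by simp [hp, hpd]) (by simpa using hmin) _

theorem pairwise_fareySeq (n : ℕ) : (fareySeq n).Pairwise (· ≤ ·) := Finset.pairwise_sort _ _

theorem mem_fareySeq {n : ℕ} {x : ℚ} :
    x ∈ fareySeq n ↔ ∃ p : ℕ × ℕ, p.1 ≤ p.2 ∧ 0 < p.2 ∧ p.2 ≤ n ∧ frac p = x := by
  simp only [fareySeq, Finset.mem_sort, Finset.mem_image, Finset.mem_filter, Finset.mem_product,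
    Finset.mem_range, Finset.mem_Icc, frac]
  exact exists_congr fun p => by grind

theorem IsFareyPath.before_fareySeq {L : List Bool} (h : IsFareyPath L) (hne : L ≠ []) :
    before (fareySeq (node L).2) (frac (node L)) = frac (lowerParent L) := by
  obtain ⟨-, -, hlower⟩ := h.parents_bounds hne
  refine before_eq (pairwise_fareySeq _) (mem_fareySeq.2 ⟨_, hlower.le, lowerParent_pos L,
    Nat.le_add_right _ _, rfl⟩) (frac_lowerParent_lt_frac_node L) fun x hx hxnode => ?_
  obtain ⟨p, -, hp, hpn, rfl⟩ := mem_fareySeq.1 hx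
  by_contra! hlt
  have hle : (node (true :: L)).2 ≤ p.2 := node_snd_le_of_between
    ((frac_lt_frac (lowerParent_pos L) hp).1 hlt) ((frac_lt_frac hp (node_pos L)).1 hxnode)
  rw [node_true, Prod.snd_add] at hle
  have := lowerParent_pos L
  omega

theorem IsFareyPath.after_fareySeq {L : List Bool} (h : IsFareyPath L) (hne : L ≠ []) :
    after (fareySeq (node L).2) (frac (node L)) = frac (upperParent L) := by
  obtain ⟨hpos, hupper, -⟩ := h.parents_bounds hne
  refine after_eq (pairwise_fareySeq _) (mem_fareySeq.2 ⟨_, hupper, hpos, Nat.le_add_left _ _, rfl⟩)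
    (frac_node_lt_frac_upperParent hpos) fun x hx hxnode => ?_
  obtain ⟨p, -, hp, hpn, rfl⟩ := mem_fareySeq.1 hx
  by_contra! hlt
  have hle : (node (false :: L)).2 ≤ p.2 := by
    refine node_snd_le_of_between (m := p.1) ?_ ((frac_lt_frac hp hpos).1 hlt)
    rw [lowerParent_false]
    exact (frac_lt_frac (node_pos L) hp).1 hxnode
  rw [node_false, Prod.snd_add] at hle
  omega

/-! ### The Farey plan -/

/-- The fractions at the nodes on the path to a node of the Stern–Brocot tree, last one first. -/
def pathFractions (L : List Bool) : List ℚ := L.tails.map fun L' => frac (node L')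

theorem pathFractions_cons (t : Bool) (L : List Bool) :
    pathFractions (t :: L) = frac (node (t :: L)) :: pathFractions L := rfl

theorem pathFractions_eq_cons_tail (L : List Bool) :
    pathFractions L = frac (node L) :: (pathFractions L).tail := by
  cases L <;> rfl

/-- The invariant of the loop of Algorithm Farey Plan: at the node reached by `L`, the current
sequence `X` contains the node between its two parents, with nothing else in between. -/
structure IsFareyState (X : List ℚ) (L : List Bool) : Prop where
  sorted : X.Pairwise (· ≤ ·)
  isFareyPath : IsFareyPath L
  lowerParent_mem : frac (lowerParent L) ∈ X
  node_mem : frac (node L) ∈ X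
  upperParent_mem : L ≠ [] → frac (upperParent L) ∈ X
  gap : ∀ x ∈ X, x ≤ frac (lowerParent L) ∨ x = frac (node L) ∨ L ≠ [] ∧ frac (upperParent L) ≤ x

/-- The fraction `f` lies strictly between the parents of the node reached by `L`, that is, in the
subtree of this node; the upper parent of the root is infinite. -/
def IsBetweenParents (f : ℚ) (L : List Bool) : Prop :=
  frac (lowerParent L) < f ∧ (L ≠ [] → f < frac (upperParent L))

namespace IsFareyState

variable {X : List ℚ} {L : List Bool} (h : IsFareyState X L)

include h

theorem frac_node_lt (hne : L ≠ []) : frac (node L) < frac (upperParent L) :=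
  frac_node_lt_frac_upperParent (h.isFareyPath.parents_bounds hne).1

theorem mediant_before :
    mediant (frac (node L)) (before X (frac (node L))) = frac (node (true :: L)) := by
  have hlt := frac_lowerParent_lt_frac_node L
  have hbefore : before X (frac (node L)) = frac (lowerParent L) := by
    refine before_eq h.sorted h.lowerParent_mem hlt fun x hx hxnode => ?_
    rcases h.gap x hx with hle | rfl | ⟨hne, hge⟩
    · exact hle
    · exact absurd hxnode (lt_irrefl _)
    · exact absurd hxnode ((h.frac_node_lt hne).le.trans hge).not_gt
  rw [hbefore, node_true, mediant_frac (node_pos L) (coprime_node L) (lowerParent_pos L)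
    (coprime_lowerParent L)]

theorem mediant_after (hne : L ≠ []) :
    mediant (frac (node L)) (after X (frac (node L))) = frac (node (false :: L)) := by
  have hafter : after X (frac (node L)) = frac (upperParent L) := by
    refine after_eq h.sorted (h.upperParent_mem hne) (h.frac_node_lt hne) fun x hx hxnode => ?_
    rcases h.gap x hx with hle | rfl | ⟨-, hge⟩
    · exact absurd hxnode (hle.trans (frac_lowerParent_lt_frac_node L).le).not_gt
    · exact absurd hxnode (lt_irrefl _)
    · exact hge
  rw [hafter, node_false, mediant_frac (node_pos L) (coprime_node L)
    (h.isFareyPath.parents_bounds hne).1 (coprime_upperParent L)]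

theorem insert_true :
    IsFareyState (X.orderedInsert (· ≤ ·) (frac (node (true :: L)))) (true :: L) where
  sorted := h.sorted.orderedInsert _ _
  isFareyPath := h.isFareyPath.cons_true
  lowerParent_mem := (List.mem_orderedInsert _).2 (Or.inr h.lowerParent_mem)
  node_mem := (List.mem_orderedInsert _).2 (Or.inl rfl)
  upperParent_mem _ := (List.mem_orderedInsert _).2 (Or.inr h.node_mem)
  gap x hx := by
    rw [lowerParent_true, upperParent_true]
    rcases (List.mem_orderedInsert _).1 hx with rfl | hx
    · exact Or.inr (Or.inl rfl)
    · rcases h.gap x hx with hle | rfl | ⟨hne, hge⟩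
      · exact Or.inl hle
      · exact Or.inr (Or.inr ⟨by simp, le_rfl⟩)
      · exact Or.inr (Or.inr ⟨by simp, (h.frac_node_lt hne).le.trans hge⟩)

theorem insert_false (hne : L ≠ []) :
    IsFareyState (X.orderedInsert (· ≤ ·) (frac (node (false :: L)))) (false :: L) where
  sorted := h.sorted.orderedInsert _ _
  isFareyPath := h.isFareyPath.cons false hne
  lowerParent_mem := by
    rw [lowerParent_false]
    exact (List.mem_orderedInsert _).2 (Or.inr h.node_mem)
  node_mem := (List.mem_orderedInsert _).2 (Or.inl rfl)
  upperParent_mem _ := (List.mem_orderedInsert _).2 (Or.inr (h.upperParent_mem hne))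
  gap x hx := by
    rw [lowerParent_false, upperParent_false]
    rcases (List.mem_orderedInsert _).1 hx with rfl | hx
    · exact Or.inr (Or.inl rfl)
    · rcases h.gap x hx with hle | rfl | ⟨-, hge⟩
      · exact Or.inl (hle.trans (frac_lowerParent_lt_frac_node L).le)
      · exact Or.inl le_rfl
      · exact Or.inr (Or.inr ⟨by simp, hge⟩)

theorem node_snd_le_den {f : ℚ} (hf : IsBetweenParents f L) : (node L).2 ≤ f.den := by
  obtain ⟨hlower, hupper⟩ := hf
  rcases eq_or_ne L [] with rfl | hne
  · exact f.den_pos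
  · have hf0 : 0 ≤ f := le_trans (div_nonneg (Nat.cast_nonneg _) (Nat.cast_nonneg _)) hlower.le
    have hpos := (h.isFareyPath.parents_bounds hne).1
    specialize hupper hne
    rw [← frac_natAbs_num_den hf0, frac_lt_frac (lowerParent_pos L) f.den_pos] at hlower
    rw [← frac_natAbs_num_den hf0, frac_lt_frac f.den_pos hpos] at hupper
    exact node_snd_le_of_between hlower hupper

theorem exists_fareyLoop {f : ℚ} (hf : f ≤ 1) (hL : IsBetweenParents f L) {n : ℕ}
    (hn : f.den < n + (node L).2) : ∃ L', IsFareyPath L' ∧ frac (node L') = f ∧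
      (fareyLoop f n X (frac (node L))).reverse ++ (pathFractions L).tail = pathFractions L' := by
  induction n generalizing X L with
  | zero => exact absurd (h.node_snd_le_den hL) (by omega)
  | succ n ih =>
    rw [fareyLoop]
    split_ifs with heq hlt
    · exact ⟨L, h.isFareyPath, heq, (pathFractions_eq_cons_tail L).symm⟩
    · have hne : L ≠ [] := by
        rintro rfl
        exact hlt.not_ge (by simpa [frac, node, diagonal, side] using hf)
      have hpos := (h.isFareyPath.parents_bounds hne).1
      rw [h.mediant_after hne, List.reverse_cons, List.append_assoc]
      have hbetween : IsBetweenParents f (false :: L) :=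
        ⟨by rwa [lowerParent_false], fun _ => hL.2 hne⟩
      have hloop := ih (h.insert_false hne) hbetween (by rw [node_false, Prod.snd_add]; omega)
      rwa [pathFractions_cons, List.tail_cons, pathFractions_eq_cons_tail L] at hloop
    · have hpos := lowerParent_pos L
      rw [h.mediant_before, List.reverse_cons, List.append_assoc]
      have hbetween : IsBetweenParents f (true :: L) :=
        ⟨hL.1, fun _ => lt_of_le_of_ne (not_lt.1 hlt) (Ne.symm heq)⟩
      have hloop := ih h.insert_true hbetween (by rw [node_true, Prod.snd_add]; omega)
      rwa [pathFractions_cons, List.tail_cons, pathFractions_eq_cons_tail L] at hloop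

end IsFareyState

theorem isFareyState_fareySeq_one : IsFareyState (fareySeq 1) [] where
  sorted := pairwise_fareySeq 1
  isFareyPath := .nil
  lowerParent_mem := mem_fareySeq.2 ⟨(0, 1), zero_le_one, one_pos, le_rfl, rfl⟩
  node_mem := mem_fareySeq.2 ⟨(1, 1), le_rfl, one_pos, le_rfl, rfl⟩
  upperParent_mem hne := absurd rfl hne
  gap x hx := by
    obtain ⟨⟨a, b⟩, hab, hb, hb', rfl⟩ := mem_fareySeq.1 hx
    obtain rfl : b = 1 := le_antisymm hb' hb
    interval_cases a
    · exact Or.inl le_rfl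
    · exact Or.inr (Or.inl rfl)

theorem exists_fareyLoop_eq_pathFractions {f : ℚ} (hf0 : 0 < f) (hf : f ≤ 1) :
    ∃ L, IsFareyPath L ∧ frac (node L) = f ∧
      (fareyLoop f f.den (fareySeq 1) 1).reverse = pathFractions L := by
  have hroot : frac (node []) = 1 := by norm_num [frac, node, diagonal, side]
  have hbetween : IsBetweenParents f [] :=
    ⟨by simpa [frac, lowerParent, side] using hf0, fun hne => absurd rfl hne⟩
  simpa [hroot, pathFractions] using
    isFareyState_fareySeq_one.exists_fareyLoop hf hbetween (Nat.lt_succ_self f.den)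

/-! ### Edges in the Stern–Brocot tree -/

/-- The lattice vector with coordinates `p`, the coefficient of `P` last. -/
def ofCoords (P Q : Pt) : ℕ × ℕ →+ Pt where
  toFun p := p.1 • Q + p.2 • P
  map_zero' := by simp
  map_add' p r := by simp only [Prod.fst_add, Prod.snd_add, add_smul]; abel

theorem ofCoords_apply (P Q : Pt) (p : ℕ × ℕ) : ofCoords P Q p = p.1 • Q + p.2 • P := rfl

theorem ofCoords_side (P Q : Pt) (L : List Bool) (i : Bool) :
    ofCoords P Q (side (0, 1) (1, 0) L i) = side P Q L i := by
  rw [← map_side]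
  simp [ofCoords_apply]

theorem ofCoords_node (P Q : Pt) (L : List Bool) : ofCoords P Q (node L) = diagonal P Q L := by
  rw [node, diagonal, map_add, ofCoords_side, ofCoords_side, diagonal]

theorem isUnitFrame_unitVec (k : ℕ) : IsUnitFrame (unitVec k) (unitVec (k + 1)) := by
  have hnorm : sqNorm (unitVec k) = 1 := by
    induction k with
    | zero => rfl
    | succ k ih => rw [unitVec, Function.iterate_succ_apply', sqNorm_rot]; exact ih
  exact Or.inl ⟨hnorm, Function.iterate_succ_apply' _ _ _⟩

namespace Edge

variable (e : Edge)

/-- The two unit vectors of the defining pair of `e`, the one of the larger coordinate first. -/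
def frame : Pt × Pt :=
  if e.x < e.y then (unitVec (e.pair + 1 : ℕ), unitVec e.pair)
  else (unitVec e.pair, unitVec (e.pair + 1 : ℕ))

/-- The two coordinates of `e`, the larger one last. -/
def coords : ℕ × ℕ := if e.x < e.y then (e.x, e.y) else (e.y, e.x)

theorem vec_eq_ofCoords : e.vec = ofCoords e.frame.1 e.frame.2 e.coords := by
  rw [vec, ofCoords_apply, frame, coords]
  split_ifs <;> simp [add_comm]

theorem phi_eq_frac : e.phi = frac e.coords := by
  rw [phi, frac, coords]
  split_ifs <;> rfl

theorem isUnitFrame_frame : IsUnitFrame e.frame.1 e.frame.2 := by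
  rw [frame]
  split_ifs
  · exact (isUnitFrame_unitVec _).swap
  · exact isUnitFrame_unitVec _

theorem coprime_coords : e.coords.1.Coprime e.coords.2 := by
  rw [coords]
  split_ifs
  · exact e.coprime
  · exact e.coprime.symm

section PhiInv

variable {p : ℕ × ℕ} (hp : 0 < p.2) (hcoprime : p.1.Coprime p.2)

include hp hcoprime

theorem phiInv_frac : (e.phiInv (frac p)).pair = e.pair ∧
    (e.phiInv (frac p)).x = (if e.x < e.y then p.1 else p.2) ∧
      (e.phiInv (frac p)).y = (if e.x < e.y then p.2 else p.1) := by
  rw [phiInv]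
  split_ifs <;> simp [num_frac hp hcoprime, den_frac hp hcoprime]

theorem vec_phiInv_frac : (e.phiInv (frac p)).vec = ofCoords e.frame.1 e.frame.2 p := by
  obtain ⟨hpair, hx, hy⟩ := e.phiInv_frac hp hcoprime
  rw [vec, hpair, hx, hy, frame, ofCoords_apply]
  split_ifs <;> simp [add_comm]

theorem sqLength_phiInv_frac :
    (e.phiInv (frac p)).sqLength = p.1 ^ 2 + p.1 * p.2 + p.2 ^ 2 := by
  obtain ⟨-, hx, hy⟩ := e.phiInv_frac hp hcoprime
  rw [sqLength, hx, hy]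
  split_ifs
  · rfl
  · ring

theorem frame_phiInv_frac (hlt : p.1 < p.2) : (e.phiInv (frac p)).frame = e.frame := by
  obtain ⟨hpair, hx, hy⟩ := e.phiInv_frac hp hcoprime
  rw [frame, frame, hpair, hx, hy]
  split_ifs <;> first | rfl | omega

theorem coords_phiInv_frac (hle : p.1 ≤ p.2) : (e.phiInv (frac p)).coords = p := by
  obtain ⟨-, hx, hy⟩ := e.phiInv_frac hp hcoprime
  rw [coords, hx, hy]
  grind

end PhiInv

/-- The edge `e` is the diagonal of the parallelogram reached by `L` from `P` and `Q`, where `P`,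
`Q` is the frame of `e`. For the edge `(1, 1)`, the parent of edges with either order of the
coordinates, the frame may be exchanged. -/
structure IsNode (P Q : Pt) (L : List Bool) : Prop where
  coords_eq : e.coords = node L
  frame_eq : e.frame = (P, Q) ∨ L = [] ∧ e.frame = (Q, P)

namespace IsNode

variable {e} {P Q : Pt} {L : List Bool}

theorem frame_eq_of_ne_nil (h : e.IsNode P Q L) (hne : L ≠ []) : e.frame = (P, Q) :=
  h.frame_eq.resolve_right fun hnil => hne hnil.1

theorem vec_eq (h : e.IsNode P Q L) : e.vec = diagonal P Q L := by
  rw [vec_eq_ofCoords, h.coords_eq]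
  rcases h.frame_eq with hframe | ⟨rfl, hframe⟩
  · rw [hframe, ofCoords_node]
  · rw [hframe, ofCoords_node, diagonal, diagonal]
    exact add_comm _ _

theorem x_eq_one_and_y_eq_one_iff (h : e.IsNode P Q L) (hL : IsFareyPath L) :
    e.x = 1 ∧ e.y = 1 ↔ L = [] := by
  have hcoords := h.coords_eq
  rw [coords] at hcoords
  constructor
  · intro hone
    by_contra hne
    have hlt := hL.node_fst_lt_snd hne
    rw [← hcoords, if_neg (by omega)] at hlt
    omega
  · rintro rfl
    have hroot : node [] = (1, 1) := rfl
    rw [hroot] at hcoords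
    split_ifs at hcoords <;> simp_all

theorem neighbors_eq (h : e.IsNode P Q L) (hL : IsFareyPath L) (hne : L ≠ []) :
    e.neighbors = (e.phiInv (frac (lowerParent L)), e.phiInv (frac (upperParent L))) := by
  rw [neighbors, if_neg (mt (h.x_eq_one_and_y_eq_one_iff hL).1 hne), phi_eq_frac, h.coords_eq,
    den_frac (node_pos L) (coprime_node L), hL.before_fareySeq hne, hL.after_fareySeq hne]

theorem vec_phiInv_lowerParent (h : e.IsNode P Q L) (hne : L ≠ []) :
    (e.phiInv (frac (lowerParent L))).vec = side P Q L true := by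
  rw [e.vec_phiInv_frac (lowerParent_pos L) (coprime_lowerParent L), h.frame_eq_of_ne_nil hne]
  exact ofCoords_side P Q L true

theorem vec_phiInv_upperParent (h : e.IsNode P Q L) (hL : IsFareyPath L) (hne : L ≠ []) :
    (e.phiInv (frac (upperParent L))).vec = side P Q L false := by
  rw [e.vec_phiInv_frac (hL.parents_bounds hne).1 (coprime_upperParent L),
    h.frame_eq_of_ne_nil hne]
  exact ofCoords_side P Q L false

theorem exists_vec_neighbors (h : e.IsNode P Q L) (hL : IsFareyPath L) :
    ∃ i, e.neighbors.1.vec = side P Q L i ∧ e.neighbors.2.vec = side P Q L !i := by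
  by_cases hne : L = []
  · have hone := (h.x_eq_one_and_y_eq_one_iff hL).2 hne
    have hframe := h.frame_eq
    rw [frame, if_neg (by omega)] at hframe
    subst hne
    rw [neighbors, if_pos hone]
    rcases hframe with hframe | ⟨-, hframe⟩ <;> obtain ⟨rfl, rfl⟩ := Prod.mk.inj hframe
    · exact ⟨false, by simp [vec, side]⟩
    · exact ⟨true, by simp [vec, side]⟩
  · rw [h.neighbors_eq hL hne]
    exact ⟨true, h.vec_phiInv_lowerParent hne, h.vec_phiInv_upperParent hL hne⟩

theorem flip_eq (h : e.IsNode P Q L) (hL : IsFareyPath L) (v : Pt) :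
    e.flip v = parallelogramFlip P Q L v := by
  obtain ⟨i, hfst, hsnd⟩ := h.exists_vec_neighbors hL
  rw [Edge.flip, Edge.at, parallelogramFlip, h.vec_eq, hfst, hsnd]
  cases i
  · rw [Sym2.eq_swap, Bool.not_false]
  · rfl

theorem vec_shorterNeighbor {t : Bool} (h : e.IsNode P Q (t :: L)) (hL : IsFareyPath (t :: L)) :
    e.shorterNeighbor.vec = side P Q L t := by
  have hne := List.cons_ne_nil t L
  obtain ⟨hpos, -, -⟩ := hL.parents_bounds hne
  rw [shorterNeighbor, h.neighbors_eq hL hne,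
    e.sqLength_phiInv_frac (lowerParent_pos _) (coprime_lowerParent _),
    e.sqLength_phiInv_frac hpos (coprime_upperParent _)]
  cases t
  · rw [if_neg, h.vec_phiInv_upperParent hL hne, side_cons_self]
    have hlower := lowerParent_pos L
    rw [lowerParent_false, upperParent_false, node_eq_add, Prod.fst_add, Prod.snd_add, not_le]
    exact add_lt_add_of_le_of_lt (by gcongr <;> omega) (by gcongr; omega)
  · rw [if_pos, h.vec_phiInv_lowerParent hne, side_cons_self]
    rw [lowerParent_true, upperParent_true, node_eq_add, Prod.fst_add, Prod.snd_add]
    gcongr <;> omega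

theorem parent {t : Bool} (h : e.IsNode P Q (t :: L)) (hL : IsFareyPath (t :: L)) :
    (e.phiInv (frac (node L))).IsNode P Q L := by
  have hframe := h.frame_eq_of_ne_nil (List.cons_ne_nil t L)
  rcases eq_or_ne L [] with rfl | hne
  · refine ⟨e.coords_phiInv_frac one_pos (coprime_node []) le_rfl, ?_⟩
    obtain ⟨hpair, hx, hy⟩ := e.phiInv_frac one_pos (coprime_node [])
    have hroot : node [] = (1, 1) := rfl
    rw [hroot] at hpair hx hy ⊢
    rw [frame] at hframe ⊢
    rw [hpair, hx, hy, ite_self, if_neg (lt_irrefl 1)]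
    split_ifs at hframe
    · exact Or.inr ⟨rfl, congrArg Prod.swap hframe⟩
    · exact Or.inl hframe
  · have hlt := hL.of_cons.node_fst_lt_snd hne
    exact ⟨e.coords_phiInv_frac (node_pos L) (coprime_node L) hlt.le,
      Or.inl ((e.frame_phiInv_frac (node_pos L) (coprime_node L) hlt).trans hframe)⟩

theorem flipPlanAux_eq (h : e.IsNode P Q L) (hL : IsFareyPath L) (v : Pt) :
    flipPlanAux (pathFractions L) e v = plan P Q L v := by
  induction L generalizing e v with
  | nil => exact congrArg (FlipPoset.mk {·} ∅) (h.flip_eq hL v)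
  | cons t L ih =>
    have hparent := h.parent hL
    rw [pathFractions_cons, pathFractions_eq_cons_tail L, flipPlanAux,
      ← pathFractions_eq_cons_tail L, ih hparent hL.of_cons, ih hparent hL.of_cons,
      h.vec_shorterNeighbor hL, h.flip_eq hL, hparent.flip_eq hL.of_cons,
      hparent.flip_eq hL.of_cons]
    rfl

end IsNode

/-- The edge `e` is a unit vector, so that its Farey plan is empty. -/
def IsUnitVector : Prop := (e.x = 0 ∧ e.y = 1) ∨ (e.x = 1 ∧ e.y = 0)

variable {e}

theorem coords_bounds_of_not_isUnitVector (h : ¬ e.IsUnitVector) :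
    0 < e.coords.1 ∧ e.coords.1 ≤ e.coords.2 := by
  have hx : e.x ≠ 0 := fun hx => h (Or.inl ⟨hx, by simpa [hx] using e.coprime⟩)
  have hy : e.y ≠ 0 := fun hy => h (Or.inr ⟨by simpa [hy] using e.coprime, hy⟩)
  rw [coords]
  split_ifs <;> constructor <;> dsimp only <;> omega

theorem exists_isNode_and_flipPlan_eq (h : ¬ e.IsUnitVector) : ∃ P Q L, IsUnitFrame P Q ∧
    IsFareyPath L ∧ e.IsNode P Q L ∧ ∀ v, e.flipPlan v = plan P Q L v := by
  obtain ⟨hpos, hle⟩ := coords_bounds_of_not_isUnitVector h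
  have hden : 0 < e.coords.2 := hpos.trans_le hle
  obtain ⟨L, hL, hfrac, hloop⟩ := exists_fareyLoop_eq_pathFractions (f := e.phi)
    (by rw [phi_eq_frac, frac]; positivity)
    (by rw [phi_eq_frac, frac]; exact div_le_one_of_le₀ (by exact_mod_cast hle) (by positivity))
  have hcoords : node L = e.coords :=
    eq_of_frac_eq (node_pos L) (coprime_node L) hden e.coprime_coords (hfrac.trans e.phi_eq_frac)
  have hnode : e.IsNode e.frame.1 e.frame.2 L := ⟨hcoords.symm, Or.inl rfl⟩
  refine ⟨_, _, L, e.isUnitFrame_frame, hL, hnode, fun v => ?_⟩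
  have hplan : e.fareyPlan = fareyLoop e.phi e.phi.den (fareySeq 1) 1 := if_neg h
  rw [flipPlan, hplan, hloop, hnode.flipPlanAux_eq hL]

theorem IsUnitVector.fareyPlan_eq (h : e.IsUnitVector) : e.fareyPlan = [] := if_pos h

theorem IsUnitVector.flipPlan_eq (h : e.IsUnitVector) (v : Pt) : e.flipPlan v = ⟨∅, ∅⟩ := by
  rw [flipPlan, h.fareyPlan_eq]
  rfl

theorem IsUnitVector.at_mem_edges {Ω : Set ℂ} {T : Set (Finset Pt)}
    (hT : IsEquilateralTriangulation Ω T) (h : e.IsUnitVector) {v : Pt} (hv : e.seg v ⊆ Ω) :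
    e.at v ∈ edges T := by
  have hframe := isUnitFrame_unitVec e.pair
  rcases h with ⟨hx, hy⟩ | ⟨hx, hy⟩
  · have hvec : e.vec = unitVec (e.pair + 1 : ℕ) := by simp [vec, hx, hy]
    rw [seg, hvec] at hv
    rw [Edge.at, hvec]
    exact hT.mem_edges_of_unit hframe.swap hv
  · have hvec : e.vec = unitVec e.pair := by simp [vec, hx, hy]
    rw [seg, hvec] at hv
    rw [Edge.at, hvec]
    exact hT.mem_edges_of_unit hframe hv

end Edge

/-! ### Adjacent copies -/

namespace Edge.IsNode

variable {e : Edge} {P Q : Pt} {L : List Bool}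

theorem newHalf_mem_halves (h : e.IsNode P Q L) (hL : IsFareyPath L) (v : Pt) (i : Bool) :
    newHalf P Q L v i ∈ e.halves v := by
  obtain ⟨j, hfst, hsnd⟩ := h.exists_vec_neighbors hL
  rw [halves, h.vec_eq, hfst, hsnd, Finset.mem_insert, Finset.mem_singleton]
  rcases Bool.eq_or_eq_not i j with rfl | rfl
  · exact Or.inl rfl
  · exact Or.inr rfl

theorem at_mem_edges (h : e.IsNode P Q L) (hbasis : IsLatticeBasis P Q) {T : Set (Finset Pt)}
    {v : Pt} {i : Bool} (hv : newHalf P Q L v i ∈ T) : e.at v ∈ edges T := by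
  refine ⟨v, v + diagonal P Q L, fun heq => ?_, by rw [Edge.at, h.vec_eq], _, hv,
    by simp [newHalf], by simp [newHalf]⟩
  have hlt := hbasis.one_lt_height_diagonal L
  rw [left_eq_add.1 heq, map_zero] at hlt
  exact absurd hlt (by norm_num)

theorem exists_subset_newHalf (h : e.IsNode P Q L) (hL : IsFareyPath L)
    (hbasis : IsLatticeBasis P Q) {v : Pt} {s : Sym2 Pt} (hs : s ∈ e.sides v) :
    ¬ s.IsDiag ∧ ∃ i, s.toFinset ⊆ newHalf P Q L v i := by
  have hside : ∀ i, side P Q L i ≠ 0 := fun i hzero => by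
    simpa [hzero] using hbasis.height_side_pos L i
  have hsides : ∃ i, s = s(v, v + side P Q L i) ∨ s = s(v + side P Q L i, v + diagonal P Q L) := by
    obtain ⟨j, hfst, hsnd⟩ := h.exists_vec_neighbors hL
    rw [sides, h.vec_eq, hfst, hsnd] at hs
    simp only [Finset.mem_insert, Finset.mem_singleton] at hs
    rcases hs with rfl | rfl | rfl | rfl
    exacts [⟨j, Or.inl rfl⟩, ⟨!j, Or.inl rfl⟩, ⟨j, Or.inr rfl⟩, ⟨!j, Or.inr rfl⟩]
  obtain ⟨i, rfl | rfl⟩ := hsides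
  · exact ⟨by simpa using hside i, i,
      by simp [newHalf, Sym2.toFinset_mk_eq, Finset.insert_subset_iff]⟩
  · exact ⟨by simpa [diagonal_eq_add_side P Q L i] using hside !i, i,
      by simp [newHalf, Sym2.toFinset_mk_eq]⟩

end Edge.IsNode

theorem card_newHalf_inter {P Q : Pt} (hbasis : IsLatticeBasis P Q) {L : List Bool} {u v : Pt}
    (huv : u ≠ v) {i j : Bool} {s : Sym2 Pt} (hs : ¬ s.IsDiag)
    (hu : s.toFinset ⊆ newHalf P Q L u i) (hv : s.toFinset ⊆ newHalf P Q L v j) :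
    (newHalf P Q L u i ∩ newHalf P Q L v j).card = 2 := by
  refine le_antisymm (Nat.lt_succ_iff.1 (lt_of_not_ge fun hcard => huv ?_)) ?_
  · have hle : ∀ w k, (newHalf P Q L w k).card ≤ 3 := fun _ _ => Finset.card_le_three
    have hfst := Finset.eq_of_subset_of_card_le Finset.inter_subset_left ((hle u i).trans hcard)
    have hsnd := Finset.eq_of_subset_of_card_le Finset.inter_subset_right ((hle v j).trans hcard)
    exact (hbasis.newHalf_inj (hfst.symm.trans hsnd)).2.1
  · rw [← Sym2.card_toFinset_of_not_isDiag s hs]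
    exact Finset.card_le_card (Finset.subset_inter hu hv)

theorem Edge.IsNode.adjacentCopies {e : Edge} {P Q : Pt} {L : List Bool} (h : e.IsNode P Q L)
    (hL : IsFareyPath L) (hbasis : IsLatticeBasis P Q) {T : Set (Finset Pt)} {u v : Pt}
    (hadjacent : AdjacentPlans e u v) (hu : ∀ i, newHalf P Q L u i ∈ T)
    (hv : ∀ i, newHalf P Q L v i ∈ T) : AdjacentCopies T e u v := by
  obtain ⟨-, huv, s, hs⟩ := hadjacent
  obtain ⟨hsu, hsv⟩ := Finset.mem_inter.1 hs
  obtain ⟨hdiag, i, hi⟩ := h.exists_subset_newHalf hL hbasis hsu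
  obtain ⟨-, j, hj⟩ := h.exists_subset_newHalf hL hbasis hsv
  exact ⟨huv, h.at_mem_edges hbasis (hu i), h.at_mem_edges hbasis (hv j), _,
    h.newHalf_mem_halves hL u i, _, h.newHalf_mem_halves hL v j, hu i, hv j,
    card_newHalf_inter hbasis huv hdiag hi hj⟩

/-! ### Flip plans -/

theorem isFlipPlan_empty {T : Set (Finset Pt)} {E : Set (Sym2 Pt)} (hE : E ⊆ edges T) :
    IsFlipPlan ⟨∅, ∅⟩ T E := by
  have hmarked : (⟨∅, ∅⟩ : FlipPoset).IsMarkedGraph T fun _ => 0 := by constructor <;> simp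
  refine hmarked.isFlipPlan fun l T' hl hp => ?_
  obtain rfl : l = [] := List.eq_nil_iff_forall_not_mem.2 fun s hs => by
    simpa using (hl.2.1 s).1 hs
  cases hp
  exact hE

theorem FlipPoset.union_self (D : FlipPoset) : D.union D = D := by
  rw [union, Finset.union_self, Finset.union_self]

theorem Edge.IsNode.isFlipPlan_and_adjacentCopies {Ω : Set ℂ} {T : Set (Finset Pt)}
    (hT : IsEquilateralTriangulation Ω T) {e : Edge} {P Q : Pt} {L : List Bool}
    (hframe : IsUnitFrame P Q) (hL : IsFareyPath L) (h : e.IsNode P Q L) {u v : Pt}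
    (hu : e.seg u ⊆ Ω) (hv : e.seg v ⊆ Ω) :
    IsFlipPlan ((plan P Q L u).union (plan P Q L v)) T {e.at u, e.at v} ∧
      (AdjacentPlans e u v → ∀ (l : List Flip) (T' : Set (Finset Pt)),
        ((plan P Q L u).union (plan P Q L v)).IsLinearOrdering l → FlipPath T l T' →
        AdjacentCopies T' e u v) := by
  have hbasis := hframe.isLatticeBasis
  have hroots := (hasRoots_plan P Q L u).union (hasRoots_plan P Q L v)
  have hseg : ∀ w ∈ ({u} ∪ {v} : Set Pt), segment ℝ (emb w) (emb (w + diagonal P Q L)) ⊆ Ω := by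
    rw [← h.vec_eq]
    rintro w (rfl | rfl)
    exacts [hu, hv]
  have hmarked := hbasis.isMarkedGraph hroots
    (fun t ht a ha b hb => hT.height_le hframe ht ha hb)
    (fun w hw u' i hu' => hT.oldHalf_mem_of_isDescendant hframe (hseg w hw) hu' i)
  have hcreated {l T'} (hl) (hp : FlipPath T l T') (w) (hw : w ∈ ({u} ∪ {v} : Set Pt)) (i) :=
    hbasis.newHalf_mem_of_flipPath hroots hmarked hl hp hw i
  refine ⟨hmarked.isFlipPlan fun l T' hl hp => ?_, fun hadjacent l T' hl hp => ?_⟩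
  · rintro _ (rfl | rfl)
    · exact h.at_mem_edges hbasis (hcreated hl hp u (Or.inl rfl) true)
    · exact h.at_mem_edges hbasis (hcreated hl hp v (Or.inr rfl) true)
  · exact h.adjacentCopies hL hbasis hadjacent (hcreated hl hp u (Or.inl rfl))
      (hcreated hl hp v (Or.inr rfl))

end FareyFlip

open FareyFlip in
theorem mainTheorem4_general (Ω : Set ℂ) (T : Set (Finset Pt))
    (hT : IsEquilateralTriangulation Ω T) (e : Edge) {u v : Pt} (hu : e.seg u ⊆ Ω)
    (hv : e.seg v ⊆ Ω) :
    IsFlipPlan ((e.flipPlan u).union (e.flipPlan v)) T {e.at u, e.at v} ∧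
      (AdjacentPlans e u v → ∀ (l : List Flip) (T' : Set (Finset Pt)),
        ((e.flipPlan u).union (e.flipPlan v)).IsLinearOrdering l → FlipPath T l T' →
        AdjacentCopies T' e u v) := by
  by_cases hunit : e.IsUnitVector
  · refine ⟨?_, fun hadjacent => absurd hunit.fareyPlan_eq hadjacent.1⟩
    rw [hunit.flipPlan_eq, hunit.flipPlan_eq, FlipPoset.union_self]
    exact isFlipPlan_empty
      (Set.pair_subset (hunit.at_mem_edges hT hu) (hunit.at_mem_edges hT hv))
  · obtain ⟨P, Q, L, hframe, hL, hnode, hplan⟩ := Edge.exists_isNode_and_flipPlan_eq hunit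
    rw [hplan, hplan]
    exact hnode.isFlipPlan_and_adjacentCopies hT hframe hL hu hv

open FareyFlip in
theorem mainTheorem4 (Ω : Set ℂ) (T : Set (Finset Pt)) (hT : IsEquilateralTriangulation Ω T)
    (e : Edge) :
    (∀ u v : Pt, AdjacentPlans e u v → e.seg u ⊆ Ω → e.seg v ⊆ Ω →
      IsFlipPlan ((e.flipPlan u).union (e.flipPlan v)) T {e.at u, e.at v} ∧
      ∀ (l : List Flip) (T' : Set (Finset Pt)),
        ((e.flipPlan u).union (e.flipPlan v)).IsLinearOrdering l → FlipPath T l T' →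
        AdjacentCopies T' e u v) ∧
    (∀ v : Pt, e.seg v ⊆ Ω → IsFlipPlan (e.flipPlan v) T {e.at v}) :=
  ⟨fun u v hadjacent hu hv =>
    (mainTheorem4_general Ω T hT e hu hv).imp_right fun hcopies => hcopies hadjacent,
  fun v hv => by
    simpa only [FlipPoset.union_self, Set.pair_eq_singleton] using
      (mainTheorem4_general Ω T hT e hv hv).1⟩
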